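/- Let $l>0$, $I=(-\frac l2,\frac l2)$, $S=I\times(-\frac12,\frac12)$, and let $\hat u_1\in W^{1,2}(I)$, $\hat u_2,\hat v\in W^{2,2}(I)$. For $k=1,2$ and $g \in W^{k,2}(I)$, $W^{k,2}_{g}(I)$ denotes the functions in $W^{k,2}(I)$ that attain the boundary values of $g$ on $\partial I$ in the sense of traces up to order $k-1$. Let $$BN_{(\hat u_1,\hat u_2)}(S;\mathbb R^2)=\{y\in W^{1,2}(S;\mathbb R^2): \exists\,\xi_1\in W^{1,2}_{\hat u_1}(I),\ \xi_2\in W^{2,2}_{\hat u_2}(I)\text{ with } y_1(x)=\xi_1(x_1)-x_2\xi_2'(x_1),\ y_2(x)=\xi_2(x_1)\},$$ $\mathscr S^{1D}=BN_{(\hat u_1,\hat u_2)}(S;\mathbb R^2)\times W^{2,2}_{\hat v}(I)\times W^{1,2}_0(I)$ and $\mathcal P=BN_{(0,0)}(S;\mathbb R^2)\times W^{2,2}_0(I)\times W^{1,2}_0(I)$. Functions on $I$ are regarded as functions on $S$ independent of $x_2$. For $A\in\{W,R\}$ let $Q_A^2$ be a quadratic form on $\mathbb R^{2\times2}$ that depends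 only on the symmetric part of a matrix and is positive definite on symmetric matrices. Set $Q_A^1(q_{11},q_{12})=\min_{\alpha\in\mathbb R}Q_A^2\begin{pmatrix}q_{11}&q_{12}\\q_{12}&\alpha\end{pmatrix}$, $Q_A^0(q_{11})=\min_{z\in\mathbb R}Q_A^1(q_{11},z)$ and $\bar Q_A(x_1,x_2,x_3)=Q_A^0(x_1)+\frac1{12}Q_A^1(x_2,x_3)$. Let $\bar{\mathbb C}_A$ be the symmetric matrix (bilinear form) with $\bar{\mathbb C}_A[x,x]=\bar Q_A(x)$ for $x\in\mathbb R^3$, and $\sqrt{\bar{\mathbb C}_A}$ its positive semidefinite square root. Set $$G(y,w,\theta)=\big(\partial_1y_1+\tfrac{|w'|^2}{2},\,w'',\,\theta'\big),\qquad H(y,w,\theta\,|\,\hat w)=\big(\partial_1y_1+w'\hat w',\,w'',\,\theta'\big).$$ On $\mathscr S^{1D}$ consider the energy $\phi_0$ (without forces) and the distance $\mathcal D_0$ given by $$\phi_0(y,w,\theta)=\frac12\int_SQ_W^0\Big(\partial_1y_1+\frac{|w'|^2}2\Big)+\frac1{24}\int_IQ_W^1(w'',\theta'),$$ $$\mathcal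 D_0\big((y,w,\theta),(\tilde y,\tilde w,\tilde\theta)\big)^2=\int_SQ_R^0\Big(\partial_1y_1-\partial_1\tilde y_1+\frac{|w'|^2}2-\frac{|\tilde w'|^2}2\Big)+\frac1{12}\int_IQ_R^1(w''-\tilde w'',\theta'-\tilde\theta'),$$ and the local slope $|\partial\phi_0|_{\mathcal D_0}(u)=\limsup_{z\to u}\frac{(\phi_0(u)-\phi_0(z))^+}{\mathcal D_0(u,z)}$, where $z\to u$ means $\mathcal D_0(u,z)\to0$, $z\ne u$. Then $G(u)\in L^2(S;\mathbb R^3)$ for all $u\in\mathscr S^{1D}$, $H(p\,|\,\hat w)\in L^2(S;\mathbb R^3)$ for all $p\in\mathcal P$ and $\hat w\in W^{2,2}(I)$, and there exists an operator $\mathcal L:\mathscr S^{1D}\to L^2(S;\mathbb R^3)$ such that, for every $u=(y,w,\theta)\in\mathscr S^{1D}$: 1. $\displaystyle\int_S\mathcal L(y,w,\theta)\cdot H(\phi_y,\phi_w,\phi_\theta\,|\,w)=0$ for all $(\phi_y,\phi_w,\phi_\theta)\in\mathcal P$; 2. $\displaystyle|\partial\phi_0|_{\mathcal D_0}(y,w,\theta)=\Big\|\sqrt{\bar{\mathbb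 C}_R}^{\,-1}\big(\bar{\mathbb C}_WG(y,w,\theta)+\mathcal L(y,w,\theta)\big)\Big\|_{L^2(S;\mathbb R^3)}$; 3. the functional $\displaystyle\mathcal F(p)=\frac12\int_S\big|\sqrt{\bar{\mathbb C}_R}\,H(p\,|\,w)\big|^2-\int_S\bar{\mathbb C}_W\big[G(y,w,\theta),H(p\,|\,w)\big]$ has a unique minimizer $p_*$ over $\mathcal P$, and $\mathcal L(y,w,\theta)=\bar{\mathbb C}_RH(p_*\,|\,w)-\bar{\mathbb C}_WG(y,w,\theta)$ almost everywhere in $S$. -/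

import Mathlib

open MeasureTheory Filter Topology
open scoped ENNReal ContDiff MatrixOrder

noncomputable section

namespace Ribbon

/-! ### Domains and Sobolev spaces -/

/-- The interval `I = (-l/2, l/2)`. -/
def I (l : ℝ) : Set ℝ := Set.Ioo (-(l / 2)) (l / 2)

/-- The rectangle `S = I × (-1/2, 1/2)`. -/
def S (l : ℝ) : Set (ℝ × ℝ) := I l ×ˢ Set.Ioo (-(1 / 2) : ℝ) (1 / 2)

/-- Lebesgue measure on `I`. -/
abbrev μI (l : ℝ) : Measure ℝ := volume.restrict (I l)

/-- Lebesgue measure on `S`. -/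
abbrev μS (l : ℝ) : Measure (ℝ × ℝ) := volume.restrict (S l)

/-- `g` is the weak derivative of `f` on `I`: integration by parts holds against every smooth
function with compact support in `I`. -/
def HasWeakDeriv (l : ℝ) (f g : ℝ → ℝ) : Prop :=
  ∀ φ : ℝ → ℝ, ContDiff ℝ ∞ φ → HasCompactSupport φ → tsupport φ ⊆ I l →
    ∫ x in I l, f x * deriv φ x = -∫ x in I l, g x * φ x

/-- `g` is the weak derivative of `f` on `S` in the direction `v`. -/
def HasWeakPartial (l : ℝ) (v : ℝ × ℝ) (f g : ℝ × ℝ → ℝ) : Prop :=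
  ∀ φ : ℝ × ℝ → ℝ, ContDiff ℝ ∞ φ → HasCompactSupport φ → tsupport φ ⊆ S l →
    ∫ x in S l, f x * fderiv ℝ φ x v = -∫ x in S l, g x * φ x

/-- The Sobolev space `W^{1,2}(I)`: elements of `L²(I)` together with their weak derivative in
`L²(I)`. As weak derivatives are unique, an element is determined by its first component. -/
structure W12 (l : ℝ) where
  fn : Lp ℝ 2 (μI l)
  d1 : Lp ℝ 2 (μI l)
  weak_d1 : HasWeakDeriv l fn d1

/-- The Sobolev space `W^{2,2}(I)`: elements of `L²(I)` together with their first and second weak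
derivatives in `L²(I)`. -/
structure W22 (l : ℝ) where
  fn : Lp ℝ 2 (μI l)
  d1 : Lp ℝ 2 (μI l)
  d2 : Lp ℝ 2 (μI l)
  weak_d1 : HasWeakDeriv l fn d1
  weak_d2 : HasWeakDeriv l d1 d2

/-- The Sobolev space `W^{1,2}(S)`: elements of `L²(S)` together with their first weak partial
derivatives in `L²(S)`. -/
structure W12S (l : ℝ) where
  fn : Lp ℝ 2 (μS l)
  d1 : Lp ℝ 2 (μS l)
  d2 : Lp ℝ 2 (μS l)
  weak_d1 : HasWeakPartial l (1, 0) fn d1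
  weak_d2 : HasWeakPartial l (0, 1) fn d2

theorem hasWeakDeriv_zero (l : ℝ) :
    HasWeakDeriv l (0 : Lp ℝ 2 (μI l)) (0 : Lp ℝ 2 (μI l)) := by
  intro φ _ _ _
  have h := Lp.coeFn_zero ℝ 2 (μI l)
  rw [integral_eq_zero_of_ae, integral_eq_zero_of_ae, neg_zero]
  · filter_upwards [h] with x hx
    have hx' : ((0 : Lp ℝ 2 (μI l)) : ℝ → ℝ) x = 0 := hx
    simp only [hx', zero_mul, Pi.zero_apply]
  · filter_upwards [h] with x hx
    have hx' : ((0 : Lp ℝ 2 (μI l)) : ℝ → ℝ) x = 0 := hx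
    simp only [hx', zero_mul, Pi.zero_apply]

instance (l : ℝ) : Zero (W12 l) := ⟨⟨0, 0, hasWeakDeriv_zero l⟩⟩

instance (l : ℝ) : Zero (W22 l) := ⟨⟨0, 0, 0, hasWeakDeriv_zero l, hasWeakDeriv_zero l⟩⟩

/-- The trace of `f` on `∂I`: the continuous representative of `f` on the closed interval takes
the value `a` at the left and the value `b` at the right end point. (Every element of `W^{1,2}(I)`
has exactly one such trace.) -/
def HasTrace (l : ℝ) (f : ℝ → ℝ) (a b : ℝ) : Prop :=
  ∃ F : ℝ → ℝ, ContinuousOn F (Set.Icc (-(l / 2)) (l / 2)) ∧ F =ᵐ[μI l] f ∧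
    F (-(l / 2)) = a ∧ F (l / 2) = b

/-- `f` and `g` have the same trace on `∂I`. -/
def SameTrace (l : ℝ) (f g : ℝ → ℝ) : Prop :=
  ∃ a b : ℝ, HasTrace l f a b ∧ HasTrace l g a b

/-- `f ∈ W^{1,2}_g(I)`. -/
def W12.InBdry {l : ℝ} (g f : W12 l) : Prop := SameTrace l f.fn g.fn

/-- `f ∈ W^{2,2}_g(I)`: the boundary values of `g` are attained up to first order. -/
def W22.InBdry {l : ℝ} (g f : W22 l) : Prop :=
  SameTrace l f.fn g.fn ∧ SameTrace l f.d1 g.d1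

/-- `(y₁, y₂) ∈ W^{1,2}(S;ℝ²)` is a Bernoulli-Navier function with boundary data `(bu₁, bu₂)`:
`y₁(x) = ξ₁(x₁) - x₂ ξ₂'(x₁)` and `y₂(x) = ξ₂(x₁)` for some `ξ₁ ∈ W^{1,2}_{bu₁}(I)` and
`ξ₂ ∈ W^{2,2}_{bu₂}(I)`. -/
def IsBN {l : ℝ} (bu₁ : W12 l) (bu₂ : W22 l) (y₁ y₂ : W12S l) : Prop :=
  ∃ (ξ₁ : W12 l) (ξ₂ : W22 l), bu₁.InBdry ξ₁ ∧ bu₂.InBdry ξ₂ ∧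
    (y₁.fn =ᵐ[μS l] fun x => ξ₁.fn x.1 - x.2 * ξ₂.d1 x.1) ∧
    (y₂.fn =ᵐ[μS l] fun x => ξ₂.fn x.1)

/-- The space of triples `(y, w, θ)` in
`BN_{(bu₁,bu₂)}(S;ℝ²) × W^{2,2}_{bv}(I) × W^{1,2}_0(I)`. -/
structure S1D (l : ℝ) (bu₁ : W12 l) (bu₂ bv : W22 l) where
  y₁ : W12S l
  y₂ : W12S l
  w : W22 l
  θ : W12 l
  bn : IsBN bu₁ bu₂ y₁ y₂
  w_bdry : bv.InBdry w
  θ_bdry : W12.InBdry 0 θ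

/-- The space of test functions `BN_{(0,0)}(S;ℝ²) × W^{2,2}_0(I) × W^{1,2}_0(I)`. -/
abbrev TestSpace (l : ℝ) : Type := S1D l 0 0 0

/-! ### Quadratic forms -/

/-- The properties of the two-dimensional quadratic forms `Q_W²`, `Q_R²`: they depend only on the
symmetric part and are positive definite on symmetric matrices. -/
def IsAdmissible (Q : QuadraticForm ℝ (Matrix (Fin 2) (Fin 2) ℝ)) : Prop :=
  (∀ A, Q A = Q ((1 / 2 : ℝ) • (A + A.transpose))) ∧ ∀ A, A.IsSymm → A ≠ 0 → 0 < Q A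

variable (Q QW QR : QuadraticForm ℝ (Matrix (Fin 2) (Fin 2) ℝ))

/-- The reduced form `Q¹(q₁₁, q₁₂) = min_α Q²(q₁₁, q₁₂, α)`. -/
def Q1 (q₁₁ q₁₂ : ℝ) : ℝ := ⨅ α : ℝ, Q !![q₁₁, q₁₂; q₁₂, α]

/-- The reduced form `Q⁰(q₁₁) = min_z Q¹(q₁₁, z)`. -/
def Q0 (q₁₁ : ℝ) : ℝ := ⨅ z : ℝ, Q1 Q q₁₁ z

/-- The space `ℝ³` with its Euclidean norm. -/
abbrev E3 : Type := EuclideanSpace ℝ (Fin 3)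

/-- The extended quadratic form `Q̄(x) = Q⁰(x₁) + Q¹(x₂, x₃) / 12` on `ℝ³`. -/
def Qbar (x : E3) : ℝ := Q0 Q (x 0) + 1 / 12 * Q1 Q (x 1) (x 2)

/-- The symmetric matrix `C̄` of the bilinear form associated with `Q̄`, given by polarization
`C̄[a, b] = (Q̄(a + b) - Q̄(a) - Q̄(b)) / 2`, so that `C̄[a, a] = Q̄(a)`. -/
def Cbar : Matrix (Fin 3) (Fin 3) ℝ :=
  Matrix.of fun i j =>
    (Qbar Q (EuclideanSpace.single i 1 + EuclideanSpace.single j 1)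
      - Qbar Q (EuclideanSpace.single i 1) - Qbar Q (EuclideanSpace.single j 1)) / 2

/-- The positive semidefinite square root of `C̄`. -/
def sqrtCbar : Matrix (Fin 3) (Fin 3) ℝ := CFC.sqrt (Cbar Q)

/-! ### Energy, metric, local slope -/

variable {l : ℝ} {bu₁ : W12 l} {bu₂ bv : W22 l}

/-- The one-dimensional energy (without forces). -/
def energy (u : S1D l bu₁ bu₂ bv) : ℝ :=
  1 / 2 * (∫ x in S l, Q0 QW (u.y₁.d1 x + u.w.d1 x.1 ^ 2 / 2))
    + 1 / 24 * ∫ x in I l, Q1 QW (u.w.d2 x) (u.θ.d1 x)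

/-- The dissipation distance. -/
def dist0 (u z : S1D l bu₁ bu₂ bv) : ℝ :=
  Real.sqrt ((∫ x in S l, Q0 QR (u.y₁.d1 x - z.y₁.d1 x + u.w.d1 x.1 ^ 2 / 2 - z.w.d1 x.1 ^ 2 / 2))
    + 1 / 12 * ∫ x in I l, Q1 QR (u.w.d2 x - z.w.d2 x) (u.θ.d1 x - z.θ.d1 x))

/-- The local slope of `φ` at `u` with respect to the metric `d`: the upper limit of
`(φ(u) - φ(z))⁺ / d(u, z)` as `d(u, z) → 0`, `z ≠ u`. -/
def localSlope {X : Type*} (φ : X → ℝ) (d : X → X → ℝ) (u : X) : ℝ≥0∞ :=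
  limsup (fun z => ENNReal.ofReal (max (φ u - φ z) 0 / d u z))
    (comap (fun z => d u z) (𝓝 0) ⊓ 𝓟 {u}ᶜ)

/-- `H(y, w, θ | wh) = (∂₁y₁ + w' wh', w'', θ')`. -/
def H (p : S1D l bu₁ bu₂ bv) (wh : W22 l) (x : ℝ × ℝ) : E3 :=
  !₂[p.y₁.d1 x + p.w.d1 x.1 * wh.d1 x.1, p.w.d2 x.1, p.θ.d1 x.1]

/-- `G(y, w, θ) = (∂₁y₁ + |w'|² / 2, w'', θ')`. -/
def G (u : S1D l bu₁ bu₂ bv) (x : ℝ × ℝ) : E3 :=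
  !₂[u.y₁.d1 x + u.w.d1 x.1 ^ 2 / 2, u.w.d2 x.1, u.θ.d1 x.1]

/-- The auxiliary quadratic functional
`F(p) = ½ ∫_S |√C̄_R H(p|w)|² - ∫_S C̄_W[G(u), H(p|w)]`, where `u = (y, w, θ)`. -/
def auxF (u : S1D l bu₁ bu₂ bv) (p : TestSpace l) : ℝ :=
  1 / 2 * (∫ x in S l, ‖(sqrtCbar QR).toEuclideanLin (H p u.w x)‖ ^ 2)
    - ∫ x in S l, inner ℝ ((Cbar QW).toEuclideanLin (G u x)) (H p u.w x)

end Ribbon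

end

/-! Both functionals are quadratic after composition with `G`: the energy at u is ½⟨C̄_W G(u), G(u)⟩
in L²(S;ℝ³), and the distance from u to z is ‖√C̄_R (G(z) - G(u))‖. The image of `G` is not affine,
but the only nonlinearity is |w'|²/2. Hence G(z) - G(u) is H(p|w) plus a remainder with single
nonzero component |p_w'|²/2. In one dimension |p_w'| is bounded uniformly by ‖p_w''‖, and p_w'' is
itself a component of G(z) - G(u), so the remainder is quadratic in ‖G(z) - G(u)‖
(`exists_norm_gLp_sub_le`, `IsIncr.norm_le_norm_gLp_sub`).

To first order, motion from u is thus confined to the linear space M of all H(p|w). The slope is the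
norm of the functional h ↦ ⟨C̄_W G(u), h⟩ on M in the C̄_R inner product, that is ‖√C̄_R h₀‖ for its
Riesz representative h₀ (`localSlope_quadratic`). The representative is an orthogonal projection; it
exists because M is closed, which follows from coercivity of H(·|w) in the highest derivatives
(`exists_norm_le_linLp`). Setting L = C̄_R h₀ - C̄_W G(u), the defining property of h₀ is
orthogonality of L to M, the slope formula is an identity, and the auxiliary functional is ½‖√C̄_R
(H(p|w) - h₀)‖² up to a constant, so coercivity also gives uniqueness of the minimizer.

Configurations are compared through the quadruple (ξ₁', ξ₂'', w'', θ') of differences of highest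
derivatives. By one-dimensional Sobolev theory these quadruples fill exactly the closed subspace
`incr` of L²(I)⁴, whatever the boundary data. -/

noncomputable section

namespace Ribbon

/-! ### Local slope of quadratic functionals -/

section Slope

variable {U X : Type*} [NormedAddCommGroup X] [InnerProductSpace ℝ X]

/-- The difference quotient is at most a + K d(u, z), which tends to a along the limsup filter. -/
theorem localSlope_le_of_forall_le {φ : U → ℝ} {d : U → U → ℝ} {u : U} {a K : ℝ}
    (hd : ∀ z, 0 ≤ d u z) (ha : 0 ≤ a) (hK : 0 ≤ K)
    (h : ∀ z, φ u - φ z ≤ a * d u z + K * d u z ^ 2) :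
    localSlope φ d u ≤ ENNReal.ofReal a := by
  unfold localSlope
  set F := comap (fun z => d u z) (𝓝 0) ⊓ 𝓟 {u}ᶜ
  -- If u is isolated the filter is trivial and the limsup is zero.
  rcases F.eq_or_neBot with hF | hF
  · rw [hF]; simp
  have hd0 : Tendsto (fun z => d u z) F (𝓝 0) := tendsto_comap.mono_left inf_le_left
  have ht : Tendsto (fun z => ENNReal.ofReal (a + K * d u z)) F (𝓝 (ENNReal.ofReal a)) := by
    refine ENNReal.tendsto_ofReal ?_
    simpa using (hd0.const_mul K).const_add a
  rw [← ht.limsup_eq]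
  refine limsup_le_limsup (Eventually.of_forall fun z => ENNReal.ofReal_le_ofReal ?_)
  have hKd := mul_nonneg hK (hd z)
  -- At distance zero the quotient has its default value 0.
  rcases (hd z).eq_or_lt with h0 | h0
  · rw [← h0]; simpa using ha
  · rw [div_le_iff₀ h0]
    refine max_le ((h z).trans (by nlinarith)) (by positivity)

/-- Along the curve the energy drops at rate a² while the distance grows at rate a, so the quotients
tend to a. For a > 0 the distance is positive for small t, which keeps the curve away from u. -/
theorem le_localSlope_of_curve {φ : U → ℝ} {d : U → U → ℝ} {u : U} {a K : ℝ} (ha : 0 ≤ a)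
    (z : ℝ → U) (hu : d u u = 0)
    (hφ : ∀ t, 0 < t → t ≤ 1 → t * a ^ 2 - K * t ^ 2 ≤ φ u - φ (z t))
    (hd : ∀ t, 0 < t → t ≤ 1 → |d u (z t) - t * a| ≤ K * t ^ 2) :
    ENNReal.ofReal a ≤ localSlope φ d u := by
  rcases ha.eq_or_lt with rfl | ha
  · simp
  have hev : ∀ᶠ t in 𝓝[>] (0 : ℝ), 0 < t ∧ t ≤ 1 := by
    filter_upwards [Ioc_mem_nhdsGT (zero_lt_one' ℝ)] with t ht using ht
  have hid : Tendsto (fun t : ℝ => t) (𝓝[>] 0) (𝓝 0) := tendsto_id.mono_left nhdsWithin_le_nhds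
  have hden : Tendsto (fun t => a + K * t) (𝓝[>] (0 : ℝ)) (𝓝 a) := by
    simpa using (hid.const_mul K).const_add a
  have hden' : Tendsto (fun t => a - K * t) (𝓝[>] (0 : ℝ)) (𝓝 a) := by
    simpa using (hid.const_mul K).const_sub a
  have hnum : Tendsto (fun t => a ^ 2 - K * t) (𝓝[>] (0 : ℝ)) (𝓝 (a ^ 2)) := by
    simpa using (hid.const_mul K).const_sub (a ^ 2)
  have hratio : Tendsto (fun t => ENNReal.ofReal ((a ^ 2 - K * t) / (a + K * t))) (𝓝[>] 0)
      (𝓝 (ENNReal.ofReal a)) := by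
    refine ENNReal.tendsto_ofReal ?_
    have h := hnum.div hden ha.ne'
    have e : a ^ 2 / a = a := by field_simp
    rwa [e] at h
  have hpos : ∀ᶠ t in 𝓝[>] (0 : ℝ), 0 < d u (z t) := by
    filter_upwards [hev, hden'.eventually (lt_mem_nhds ha)] with t ht h
    have := (abs_le.1 (hd t ht.1 ht.2)).1
    nlinarith [mul_pos ht.1 h]
  have hz : Tendsto z (𝓝[>] 0) (comap (fun z => d u z) (𝓝 0) ⊓ 𝓟 {u}ᶜ) := by
    refine tendsto_inf.2 ⟨tendsto_comap_iff.2 ?_, tendsto_principal.2 ?_⟩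
    · have h1 : Tendsto (fun t => t * a - K * t ^ 2) (𝓝[>] (0 : ℝ)) (𝓝 0) := by
        simpa using (hid.mul_const a).sub ((hid.pow 2).const_mul K)
      have h2 : Tendsto (fun t => t * a + K * t ^ 2) (𝓝[>] (0 : ℝ)) (𝓝 0) := by
        simpa using (hid.mul_const a).add ((hid.pow 2).const_mul K)
      refine tendsto_of_tendsto_of_tendsto_of_le_of_le' h1 h2 ?_ ?_ <;>
      · filter_upwards [hev] with t ht
        have := abs_le.1 (hd t ht.1 ht.2)
        simp only [Function.comp]
        linarith
    · filter_upwards [hpos] with t ht h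
      rw [Set.mem_singleton_iff.1 h, hu] at ht
      exact ht.false
  calc ENNReal.ofReal a
      = limsup (fun t => ENNReal.ofReal ((a ^ 2 - K * t) / (a + K * t))) (𝓝[>] 0) :=
        hratio.limsup_eq.symm
    _ ≤ limsup (fun t => ENNReal.ofReal (max (φ u - φ (z t)) 0 / d u (z t))) (𝓝[>] 0) := by
        refine limsup_le_limsup ?_
        filter_upwards [hev, hpos, hden.eventually (lt_mem_nhds ha),
          hnum.eventually (lt_mem_nhds (show 0 < a ^ 2 by positivity))] with t ht hp hq hn
        refine ENNReal.ofReal_le_ofReal ?_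
        have h1 := hφ t ht.1 ht.2
        have h2 := (abs_le.1 (hd t ht.1 ht.2)).2
        rw [div_le_div_iff₀ hq hp]
        have h3 : t * (a ^ 2 - K * t) ≤ max (φ u - φ (z t)) 0 :=
          le_max_of_le_left (by linarith)
        have h4 : d u (z t) ≤ t * (a + K * t) := by linarith
        calc (a ^ 2 - K * t) * d u (z t) ≤ (a ^ 2 - K * t) * (t * (a + K * t)) := by gcongr
          _ = t * (a ^ 2 - K * t) * (a + K * t) := by ring
          _ ≤ _ := by gcongr
    _ = limsup (fun z => ENNReal.ofReal (max (φ u - φ z) 0 / d u z)) (map z (𝓝[>] 0)) := rfl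
    _ ≤ _ := limsup_le_limsup_of_le hz

/-- The local slope of a nonnegative quadratic energy along a configuration map `g` whose increments
at `u` agree with a linear space `M` up to quadratic errors. -/
theorem localSlope_quadratic {φ : U → ℝ} {d : U → U → ℝ} {g : U → X} {u : U} {W R : X →L[ℝ] X}
    {M : Submodule ℝ X} {h₀ : X} {c : ℝ} {z : ℝ → U} {C : ℝ}
    (hφ : ∀ z, φ z = 1 / 2 * inner ℝ (W (g z)) (g z))
    (hWsymm : ∀ x y, inner ℝ (W x) y = inner ℝ (W y) x) (hWpos : ∀ x, 0 ≤ inner ℝ (W x) x)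
    (hd : ∀ z, d u z = ‖R (g z - g u)‖) (hc : 0 < c) (hR : ∀ x, c * ‖x‖ ≤ ‖R x‖)
    (hh₀M : h₀ ∈ M) (hh₀ : ∀ h ∈ M, inner ℝ (W (g u)) h = inner ℝ (R h₀) (R h)) (hC : 0 ≤ C)
    (hup : ∀ z, ∃ h ∈ M, ‖g z - g u - h‖ ≤ C * ‖g z - g u‖ ^ 2)
    (hz : ∀ t, 0 < t → ‖g (z t) - g u - (-t) • h₀‖ ≤ C * t ^ 2) :
    localSlope φ d u = ENNReal.ofReal ‖R h₀‖ := by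
  -- Exact second-order expansion; the quadratic term is nonpositive and can be dropped in the upper
  -- bound.
  have hexp : ∀ z, φ u - φ z = - inner ℝ (W (g u)) (g z - g u)
      - 1 / 2 * inner ℝ (W (g z - g u)) (g z - g u) := by
    intro z
    simp only [hφ, map_sub, inner_sub_left, inner_sub_right]
    rw [hWsymm (g z) (g u)]
    ring
  apply le_antisymm
  -- `K` collects the cost of replacing the increment by a nearby h ∈ M, once in the pairing with
  -- W(g u) and once in the bound of ‖R h‖ by the distance; division by c² converts the squared norm
  -- of the increment into squared distance.
  · refine localSlope_le_of_forall_le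
      (K := (‖R h₀‖ * ‖R‖ * C + ‖W (g u)‖ * C) / c ^ 2)
      (fun z => by rw [hd]; positivity) (norm_nonneg _) (by positivity) fun z => ?_
    obtain ⟨h, hM, hh⟩ := hup z
    set δ := g z - g u with hδ
    have hδd : ‖δ‖ ^ 2 ≤ d u z ^ 2 / c ^ 2 := by
      rw [le_div_iff₀ (by positivity), ← mul_pow, hd]
      exact pow_le_pow_left₀ (by positivity) (by rw [mul_comm]; exact hR δ) 2
    have h1 : - inner ℝ (W (g u)) δ ≤ ‖R h₀‖ * ‖R h‖ + ‖W (g u)‖ * (C * ‖δ‖ ^ 2) := by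
      have e : inner ℝ (W (g u)) δ = inner ℝ (R h₀) (R h) + inner ℝ (W (g u)) (δ - h) := by
        rw [← hh₀ h hM, ← inner_add_right]; congr 1; abel
      have a1 := neg_le_of_abs_le (abs_real_inner_le_norm (R h₀) (R h))
      have a2 := neg_le_of_abs_le (abs_real_inner_le_norm (W (g u)) (δ - h))
      have a3 : ‖W (g u)‖ * ‖δ - h‖ ≤ ‖W (g u)‖ * (C * ‖δ‖ ^ 2) := by gcongr
      linarith
    have h2 : ‖R h‖ ≤ d u z + ‖R‖ * (C * ‖δ‖ ^ 2) := by
      have e : R h = R δ - R (δ - h) := by rw [← map_sub]; congr 1; abel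
      calc ‖R h‖ ≤ ‖R δ‖ + ‖R (δ - h)‖ := by rw [e]; exact norm_sub_le _ _
        _ ≤ d u z + ‖R‖ * ‖δ - h‖ := by rw [hd]; gcongr; exact R.le_opNorm _
        _ ≤ _ := by gcongr
    have h3 := hWpos δ
    have h4 : ‖R h₀‖ * ‖R h‖ ≤ ‖R h₀‖ * (d u z + ‖R‖ * (C * ‖δ‖ ^ 2)) := by gcongr
    have h5 : (‖R h₀‖ * ‖R‖ * C + ‖W (g u)‖ * C) * ‖δ‖ ^ 2 ≤
        (‖R h₀‖ * ‖R‖ * C + ‖W (g u)‖ * C) * (d u z ^ 2 / c ^ 2) := by gcongr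
    rw [hexp]
    calc _ ≤ ‖R h₀‖ * d u z + (‖R h₀‖ * ‖R‖ * C + ‖W (g u)‖ * C) * ‖δ‖ ^ 2 := by linarith
      _ ≤ _ := by
        have e : (‖R h₀‖ * ‖R‖ * C + ‖W (g u)‖ * C) * (d u z ^ 2 / c ^ 2) =
            (‖R h₀‖ * ‖R‖ * C + ‖W (g u)‖ * C) / c ^ 2 * d u z ^ 2 := by ring
        linarith
  -- The three terms of `K` bound the error in the linear part of the energy, its quadratic part
  -- (for t ≤ 1), and the error in the distance.
  · refine le_localSlope_of_curve (norm_nonneg _)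
      (K := ‖W (g u)‖ * C + 1 / 2 * (‖W‖ * (‖h₀‖ + C) ^ 2) + ‖R‖ * C) z (by simp [hd]) ?_ ?_
    · intro t ht ht1
      have hzt := hz t ht
      set δ := g (z t) - g u with hδ
      have h1 : - inner ℝ (W (g u)) δ ≥ t * ‖R h₀‖ ^ 2 - ‖W (g u)‖ * (C * t ^ 2) := by
        have e : inner ℝ (W (g u)) δ =
            -t * ‖R h₀‖ ^ 2 + inner ℝ (W (g u)) (δ - (-t) • h₀) := by
          rw [← real_inner_self_eq_norm_sq, ← hh₀ h₀ hh₀M, ← real_inner_smul_right,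
            ← inner_add_right]
          congr 1; abel
        have a2 := (abs_le.1 (abs_real_inner_le_norm (W (g u)) (δ - (-t) • h₀))).2
        have a3 : ‖W (g u)‖ * ‖δ - (-t) • h₀‖ ≤ ‖W (g u)‖ * (C * t ^ 2) := by gcongr
        linarith
      have h2 : ‖δ‖ ≤ t * (‖h₀‖ + C) := by
        have e : δ = (-t) • h₀ + (δ - (-t) • h₀) := by abel
        calc ‖δ‖ = ‖(-t) • h₀ + (δ - (-t) • h₀)‖ := by rw [← e]
          _ ≤ ‖(-t) • h₀‖ + ‖δ - (-t) • h₀‖ := norm_add_le _ _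
          _ ≤ t * ‖h₀‖ + C * t ^ 2 := by
            rw [norm_smul, norm_neg, Real.norm_of_nonneg ht.le]; gcongr
          _ ≤ _ := by nlinarith [mul_nonneg hC (mul_nonneg ht.le (sub_nonneg.2 ht1))]
      have h3 : inner ℝ (W δ) δ ≤ ‖W‖ * (‖h₀‖ + C) ^ 2 * t ^ 2 := by
        calc inner ℝ (W δ) δ ≤ ‖W δ‖ * ‖δ‖ := real_inner_le_norm _ _
          _ ≤ ‖W‖ * ‖δ‖ * ‖δ‖ := by gcongr; exact W.le_opNorm _
          _ = ‖W‖ * ‖δ‖ ^ 2 := by ring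
          _ ≤ ‖W‖ * (t * (‖h₀‖ + C)) ^ 2 := by gcongr
          _ = _ := by ring
      have h4 : 0 ≤ ‖R‖ * C * t ^ 2 := by positivity
      rw [hexp]
      nlinarith
    · intro t ht ht1
      have hzt := hz t ht
      have e : t * ‖R h₀‖ = ‖R ((-t) • h₀)‖ := by
        rw [map_smul, norm_smul, norm_neg, Real.norm_of_nonneg ht.le]
      rw [hd, e]
      calc |‖R (g (z t) - g u)‖ - ‖R ((-t) • h₀)‖|
          ≤ ‖R (g (z t) - g u) - R ((-t) • h₀)‖ := abs_norm_sub_norm_le _ _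
        _ ≤ ‖R‖ * ‖g (z t) - g u - (-t) • h₀‖ := by rw [← map_sub]; exact R.le_opNorm _
        _ ≤ ‖R‖ * (C * t ^ 2) := by gcongr
        _ ≤ _ := by
          have : 0 ≤ (‖W (g u)‖ * C + 1 / 2 * (‖W‖ * (‖h₀‖ + C) ^ 2)) * t ^ 2 := by positivity
          linarith

end Slope

/-! ### Reduced quadratic forms -/

section QuadraticForms

theorem ciInf_quadratic {a b c : ℝ} (hc : 0 < c) :
    ⨅ t : ℝ, (a + b * t + c * t ^ 2) = a - b ^ 2 / (4 * c) := by
  have key : ∀ t : ℝ, a + b * t + c * t ^ 2 = a - b ^ 2 / (4 * c) + c * (t + b / (2 * c)) ^ 2 := by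
    intro t; field_simp; ring
  apply le_antisymm
  · refine (ciInf_le ⟨a - b ^ 2 / (4 * c), ?_⟩ (-(b / (2 * c)))).trans ?_
    · rintro _ ⟨t, rfl⟩
      have : 0 ≤ c * (t + b / (2 * c)) ^ 2 := by positivity
      simp only [key]; linarith
    · rw [key]; simp
  · refine le_ciInf fun t => ?_
    have : 0 ≤ c * (t + b / (2 * c)) ^ 2 := by positivity
    rw [key]; linarith

variable {Q : QuadraticForm ℝ (Matrix (Fin 2) (Fin 2) ℝ)}

/-- The reduced forms evaluate Q only on symmetric matrices, so six coefficients suffice. -/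
theorem exists_apply_symm_eq (Q : QuadraticForm ℝ (Matrix (Fin 2) (Fin 2) ℝ)) :
    ∃ A B C D E F : ℝ, ∀ a b c : ℝ, Q !![a, b; b, c] =
      A * a ^ 2 + B * b ^ 2 + C * c ^ 2 + D * (a * b) + E * (a * c) + F * (b * c) := by
  refine ⟨Q !![1, 0; 0, 0], Q !![0, 1; 1, 0], Q !![0, 0; 0, 1],
    Q.polarBilin !![1, 0; 0, 0] !![0, 1; 1, 0], Q.polarBilin !![1, 0; 0, 0] !![0, 0; 0, 1],
    Q.polarBilin !![0, 1; 1, 0] !![0, 0; 0, 1], fun a b c => ?_⟩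
  have e : !![a, b; b, c] = a • !![1, 0; 0, 0] + b • !![0, 1; 1, 0] + c • !![0, 0; 0, (1 : ℝ)] := by
    ext i j; fin_cases i <;> fin_cases j <;> simp
  have hadd : ∀ x y, Q (x + y) = Q x + Q y + Q.polarBilin x y := by
    intro x y; simp [QuadraticMap.polar]
  rw [e, hadd, hadd]
  simp only [QuadraticMap.map_smul, map_add, map_smul, LinearMap.add_apply, LinearMap.smul_apply,
    smul_eq_mul]
  ring

/-- Minimizing a positive definite quadratic form over one variable gives its Schur complement,
which is again positive definite. -/
theorem IsAdmissible.exists_Q1_Q0_eq (hQ : IsAdmissible Q) :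
    ∃ p q r s : ℝ, 0 < r ∧ 0 < s ∧ 0 < p * r - q ^ 2 ∧
      (∀ a b, Q1 Q a b = p * a ^ 2 + 2 * q * (a * b) + r * b ^ 2) ∧ ∀ a, Q0 Q a = s * a ^ 2 := by
  obtain ⟨A, B, C, D, E, F, h⟩ := exists_apply_symm_eq Q
  have hpos : ∀ a b c : ℝ, a ≠ 0 ∨ b ≠ 0 ∨ c ≠ 0 → 0 < Q !![a, b; b, c] := by
    intro a b c habc
    refine hQ.2 _ (by ext i j; fin_cases i <;> fin_cases j <;> rfl) fun h0 => ?_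
    have h1 := congrFun (congrFun h0 0) 0
    have h2 := congrFun (congrFun h0 0) 1
    have h3 := congrFun (congrFun h0 1) 1
    simp at h1 h2 h3
    simp [h1, h2, h3] at habc
  have hC : 0 < C := by simpa [h] using hpos 0 0 1 (by simp)
  have h1 : ∀ a b, Q1 Q a b = (A - E ^ 2 / (4 * C)) * a ^ 2
      + 2 * (D / 2 - E * F / (4 * C)) * (a * b) + (B - F ^ 2 / (4 * C)) * b ^ 2 := by
    intro a b
    have : ∀ c, Q !![a, b; b, c] =
        (A * a ^ 2 + B * b ^ 2 + D * (a * b)) + (E * a + F * b) * c + C * c ^ 2 := by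
      intro c; rw [h]; ring
    simp only [Q1, this, ciInf_quadratic hC]
    field_simp; ring
  have h1pos : ∀ a b : ℝ, a ≠ 0 ∨ b ≠ 0 → 0 < Q1 Q a b := by
    intro a b hab
    -- The last argument is the minimizing α, so the reduced form is a value of Q at a nonzero
    -- matrix.
    have := hpos a b (-((E * a + F * b) / (2 * C))) (by tauto)
    rw [h] at this
    rw [h1]
    convert this using 1
    field_simp; ring
  set p := A - E ^ 2 / (4 * C)
  set q := D / 2 - E * F / (4 * C)
  set r := B - F ^ 2 / (4 * C)
  have hr : 0 < r := by simpa [h1] using h1pos 0 1 (by simp)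
  have hdet : 0 < p * r - q ^ 2 := by
    -- At (r, -q) the reduced form equals r times its determinant.
    have := h1pos r (-q) (Or.inl hr.ne')
    rw [h1] at this
    have e : p * r ^ 2 + 2 * q * (r * -q) + r * (-q) ^ 2 = r * (p * r - q ^ 2) := by ring
    rw [e] at this
    exact pos_of_mul_pos_right this hr.le
  refine ⟨p, q, r, (p * r - q ^ 2) / r, hr, by positivity, hdet, h1, fun a => ?_⟩
  simp only [Q0, h1, ← mul_assoc, ciInf_quadratic hr]
  field_simp; ring

/-- The matrix is block diagonal, with a 1×1 block from `Q0` and a 2×2 block from `Q1` divided by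
12, both positive definite. -/
theorem IsAdmissible.Cbar_spec (hQ : IsAdmissible Q) :
    (Cbar Q).PosDef ∧ ∀ x : E3, inner ℝ ((Cbar Q).toEuclideanLin x) x = Qbar Q x := by
  obtain ⟨p, q, r, s, hr, hs, hdet, h1, h0⟩ := hQ.exists_Q1_Q0_eq
  have hC : Cbar Q = !![s, 0, 0; 0, p / 12, q / 12; 0, q / 12, r / 12] := by
    ext i j
    fin_cases i <;> fin_cases j <;> simp [Cbar, Qbar, h1, h0] <;> ring
  have hin : ∀ x : E3, inner ℝ ((Cbar Q).toEuclideanLin x) x = Qbar Q x := by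
    intro x
    rw [hC, Qbar, h1, h0]
    simp [Matrix.toLpLin_apply, PiLp.inner_apply, Fin.sum_univ_three, dotProduct]
    ring
  refine ⟨Matrix.PosDef.of_dotProduct_mulVec_pos ?_ fun x hx => ?_, hin⟩
  · rw [hC]; ext i j; fin_cases i <;> fin_cases j <;> rfl
  · have e : dotProduct (star x) ((Cbar Q).mulVec x) = Qbar Q (WithLp.toLp 2 x) := by
      rw [← hin]
      simp [PiLp.inner_apply, dotProduct]
    rw [e]
    simp only [Qbar, h1, h0]
    have hx' : x 0 ≠ 0 ∨ x 1 ≠ 0 ∨ x 2 ≠ 0 := by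
      by_contra! h
      exact hx (by ext i; fin_cases i <;> simp [h])
    have e2 : s * x 0 ^ 2 + 1 / 12 * (p * x 1 ^ 2 + 2 * q * (x 1 * x 2) + r * x 2 ^ 2) =
        s * x 0 ^ 2 + 1 / (12 * r) * ((r * x 2 + q * x 1) ^ 2 + (p * r - q ^ 2) * x 1 ^ 2) := by
      field_simp; ring
    rw [e2]
    rcases hx' with h | h | h
    · positivity
    · positivity
    · by_cases h' : x 1 = 0
      · rw [h']
        have : 0 < (r * x 2 + q * 0) ^ 2 := by
          have : r * x 2 + q * 0 ≠ 0 := by simpa using ⟨hr.ne', h⟩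
          positivity
        positivity
      · positivity

end QuadraticForms

/-! ### The square root of C̄ -/

section SqrtCbar

variable {Q : QuadraticForm ℝ (Matrix (Fin 2) (Fin 2) ℝ)}

theorem IsAdmissible.sqrtCbar_mul_self (hQ : IsAdmissible Q) :
    sqrtCbar Q * sqrtCbar Q = Cbar Q :=
  CFC.sqrt_mul_sqrt_self _ hQ.Cbar_spec.1.posSemidef.nonneg

theorem sqrtCbar_posSemidef (Q : QuadraticForm ℝ (Matrix (Fin 2) (Fin 2) ℝ)) :
    (sqrtCbar Q).PosSemidef :=
  Matrix.nonneg_iff_posSemidef.1 (CFC.sqrt_nonneg (Cbar Q))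

theorem IsAdmissible.isUnit_det_sqrtCbar (hQ : IsAdmissible Q) : IsUnit (sqrtCbar Q).det := by
  refine isUnit_iff_ne_zero.2 fun h => ?_
  have := hQ.Cbar_spec.1.det_pos
  rw [← hQ.sqrtCbar_mul_self, Matrix.det_mul, h, mul_zero] at this
  exact this.false

end SqrtCbar

/-! ### Matrices acting on L²(·;ℝ³) -/

section MatrixAction

variable {α : Type*} [MeasurableSpace α] (μ : Measure α)

/-- The action of a matrix on the values of square integrable maps into `ℝ³`. -/
def mulLp (A : Matrix (Fin 3) (Fin 3) ℝ) : Lp E3 2 μ →L[ℝ] Lp E3 2 μ :=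
  (LinearMap.toContinuousLinearMap A.toEuclideanLin).compLpL 2 μ

variable {μ}

theorem coeFn_mulLp (A : Matrix (Fin 3) (Fin 3) ℝ) (f : Lp E3 2 μ) :
    mulLp μ A f =ᵐ[μ] fun x => A.toEuclideanLin (f x) :=
  ContinuousLinearMap.coeFn_compLpL _ _

theorem mulLp_mul (A B : Matrix (Fin 3) (Fin 3) ℝ) (f : Lp E3 2 μ) :
    mulLp μ A (mulLp μ B f) = mulLp μ (A * B) f := by
  ext1
  filter_upwards [coeFn_mulLp A (mulLp μ B f), coeFn_mulLp B f, coeFn_mulLp (A * B) f]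
    with x h1 h2 h3
  rw [h1, h2, h3]
  simp [Matrix.toLpLin_apply, Matrix.mulVec_mulVec]

theorem mulLp_one (f : Lp E3 2 μ) : mulLp μ 1 f = f := by
  ext1
  filter_upwards [coeFn_mulLp 1 f] with x h1
  rw [h1]
  simp

theorem inner_mulLp (A : Matrix (Fin 3) (Fin 3) ℝ) (f g : Lp E3 2 μ) :
    inner ℝ (mulLp μ A f) g = ∫ x, inner ℝ (A.toEuclideanLin (f x)) (g x) ∂μ := by
  rw [L2.inner_def]
  refine integral_congr_ae ?_
  filter_upwards [coeFn_mulLp A f] with x h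
  rw [h]

theorem inner_mulLp_left {A : Matrix (Fin 3) (Fin 3) ℝ} (hA : A.IsHermitian) (f g : Lp E3 2 μ) :
    inner ℝ (mulLp μ A f) g = inner ℝ f (mulLp μ A g) := by
  rw [real_inner_comm _ f, inner_mulLp, inner_mulLp]
  refine integral_congr_ae (Eventually.of_forall fun x => ?_)
  have := Matrix.isSymmetric_toEuclideanLin_iff.2 hA (f x) (g x)
  simp only [this]
  rw [real_inner_comm]

end MatrixAction

/-! ### Primitives on the interval -/

section Primitive

variable {l : ℝ}

instance (l : ℝ) : IsFiniteMeasure (μI l) := by unfold μI I; infer_instance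

theorem measurableSet_I (l : ℝ) : MeasurableSet (I l) := measurableSet_Ioo

theorem isOpen_I (l : ℝ) : IsOpen (I l) := isOpen_Ioo

theorem setIntegral_I (hl : 0 < l) (f : ℝ → ℝ) :
    ∫ x in I l, f x = ∫ x in (-(l / 2))..(l / 2), f x := by
  rw [intervalIntegral.integral_of_le (by linarith), integral_Ioc_eq_integral_Ioo]; rfl

/-- The primitive `x ↦ ∫_{-l/2}^x f` of a function on `I`, extended by zero. -/
def prim (l : ℝ) (f : ℝ → ℝ) (x : ℝ) : ℝ := ∫ t in (-(l / 2))..x, (I l).indicator f t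

theorem integrable_indicator_I {f : ℝ → ℝ} (hf : Integrable f (μI l)) :
    Integrable ((I l).indicator f) :=
  (integrable_indicator_iff (measurableSet_I l)).2 hf

theorem prim_congr {f g : ℝ → ℝ} (h : f =ᵐ[μI l] g) : prim l f = prim l g := by
  funext x
  refine intervalIntegral.integral_congr_ae ?_
  filter_upwards [(ae_restrict_iff' (measurableSet_I l)).1 h] with t ht _
  by_cases hI : t ∈ I l
  · simp [hI, ht hI]
  · simp [hI]

theorem prim_left (f : ℝ → ℝ) : prim l f (-(l / 2)) = 0 := intervalIntegral.integral_same

theorem prim_add {f g : ℝ → ℝ} (hf : Integrable f (μI l)) (hg : Integrable g (μI l)) (x : ℝ) :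
    prim l (f + g) x = prim l f x + prim l g x := by
  simp only [prim, Set.indicator_add']
  exact intervalIntegral.integral_add (integrable_indicator_I hf).intervalIntegrable
    (integrable_indicator_I hg).intervalIntegrable

theorem prim_smul (c : ℝ) (f : ℝ → ℝ) (x : ℝ) : prim l (c • f) x = c * prim l f x := by
  rw [prim, prim, ← intervalIntegral.integral_const_mul]
  congr 1; funext t
  by_cases h : t ∈ I l <;> simp [h]

theorem continuous_prim {f : ℝ → ℝ} (hf : Integrable f (μI l)) : Continuous (prim l f) :=
  intervalIntegral.continuous_primitive
    (fun _ _ => (integrable_indicator_I hf).intervalIntegrable) _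

theorem abs_prim_le {f : ℝ → ℝ} (hf : Integrable f (μI l)) (x : ℝ) :
    |prim l f x| ≤ ∫ t, |f t| ∂(μI l) := by
  calc |prim l f x| ≤ ∫ t in Set.uIoc (-(l / 2)) x, ‖(I l).indicator f t‖ :=
        (Real.norm_eq_abs _).symm.trans_le intervalIntegral.norm_integral_le_integral_norm_uIoc
    _ ≤ ∫ t, ‖(I l).indicator f t‖ :=
        setIntegral_le_integral (integrable_indicator_I hf).norm
          (Eventually.of_forall fun _ => norm_nonneg _)
    _ = ∫ t, (I l).indicator (fun t => |f t|) t := by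
        congr 1; funext t; by_cases h : t ∈ I l <;> simp [h]
    _ = _ := integral_indicator (measurableSet_I l)

theorem integrable_coe (f : Lp ℝ 2 (μI l)) : Integrable f (μI l) :=
  (Lp.memLp f).integrable one_le_two

/-- The L¹ norm is controlled by the L² norm on a bounded interval. The bound is uniform in x; it is
the Sobolev embedding used for the quadratic remainder of `G`. -/
theorem exists_abs_prim_le (l : ℝ) :
    ∃ C : ℝ, 0 ≤ C ∧ ∀ (f : Lp ℝ 2 (μI l)) (x : ℝ), |prim l f x| ≤ C * ‖f‖ := by
  refine ⟨(μI l Set.univ ^ (1 / (1 : ℝ≥0∞).toReal - 1 / (2 : ℝ≥0∞).toReal)).toReal,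
    ENNReal.toReal_nonneg, fun f x => (abs_prim_le (integrable_coe f) x).trans ?_⟩
  have h := eLpNorm_le_eLpNorm_mul_rpow_measure_univ (one_le_two (α := ℝ≥0∞))
    (Lp.aestronglyMeasurable f)
  have h1 : ∫ t, |f t| ∂(μI l) = (eLpNorm f 1 (μI l)).toReal := by
    rw [eLpNorm_one_eq_lintegral_enorm]
    exact integral_norm_eq_lintegral_enorm (Lp.aestronglyMeasurable f)
  rw [h1, Lp.norm_def, mul_comm, ← ENNReal.toReal_mul]
  refine ENNReal.toReal_mono (ENNReal.mul_ne_top (Lp.eLpNorm_ne_top f) ?_) h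
  refine ENNReal.rpow_ne_top_of_nonneg (by norm_num) (measure_ne_top _ _)

/-- Evaluation of the primitive at a point, as a continuous functional on `L²(I)`. -/
def primEval (l x : ℝ) : Lp ℝ 2 (μI l) →L[ℝ] ℝ :=
  LinearMap.mkContinuousOfExistsBound
    { toFun := fun f => prim l f x
      map_add' := fun f g => by
        rw [prim_congr (Lp.coeFn_add f g), prim_add (integrable_coe f) (integrable_coe g)]
      map_smul' := fun c f => by
        rw [prim_congr (Lp.coeFn_smul c f), prim_smul]; rfl }
    (by obtain ⟨C, -, h⟩ := exists_abs_prim_le l; exact ⟨C, fun f => h f x⟩)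

@[simp] theorem primEval_apply (x : ℝ) (f : Lp ℝ 2 (μI l)) : primEval l x f = prim l f x := rfl

theorem memLp_prim (f : Lp ℝ 2 (μI l)) : MemLp (prim l f) 2 (μI l) := by
  obtain ⟨C, -, h⟩ := exists_abs_prim_le l
  exact MemLp.of_bound (continuous_prim (integrable_coe f)).aestronglyMeasurable (C * ‖f‖)
    (Eventually.of_forall fun x => h f x)

/-- The primitive as an operator on `L²(I)`. -/
def primLp (l : ℝ) : Lp ℝ 2 (μI l) →L[ℝ] Lp ℝ 2 (μI l) :=
  LinearMap.mkContinuousOfExistsBound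
    { toFun := fun f => (memLp_prim f).toLp
      map_add' := fun f g => by
        rw [← MemLp.toLp_add, MemLp.toLp_eq_toLp_iff]
        exact Eventually.of_forall fun x => map_add (primEval l x) f g
      map_smul' := fun c f => by
        rw [← MemLp.toLp_const_smul, MemLp.toLp_eq_toLp_iff]
        exact Eventually.of_forall fun x => map_smul (primEval l x) c f }
    (by
      obtain ⟨C, hC, h⟩ := exists_abs_prim_le l
      refine ⟨_, fun f => (Lp.norm_le_of_ae_bound (C := C * ‖f‖) (by positivity) ?_).trans_eq
        (mul_assoc _ _ _).symm⟩
      filter_upwards [(memLp_prim f).coeFn_toLp] with x hx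
      exact (congrArg _ hx).trans_le (h f x))

theorem coeFn_primLp (f : Lp ℝ 2 (μI l)) : primLp l f =ᵐ[μI l] prim l f :=
  (memLp_prim f).coeFn_toLp

end Primitive

/-! ### Weak derivatives on the interval -/

section WeakDeriv

variable {l : ℝ}

theorem eq_zero_of_notMem_I {φ : ℝ → ℝ} (h : tsupport φ ⊆ I l) {x : ℝ} (hx : x ∉ I l) :
    φ x = 0 :=
  image_eq_zero_of_notMem_tsupport fun h' => hx (h h')

/-- The primitive is absolutely continuous with derivative g almost everywhere, and test functions
vanish at both ends, so integration by parts has no boundary term. -/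
theorem hasWeakDeriv_prim (hl : 0 < l) {g : ℝ → ℝ} (hg : Integrable g (μI l)) :
    HasWeakDeriv l (prim l g) g := by
  intro φ hφ _ hsupp
  have hii : IntervalIntegrable ((I l).indicator g) volume (-(l / 2)) (l / 2) :=
    (integrable_indicator_I hg).intervalIntegrable
  have h1 : φ (l / 2) = 0 := eq_zero_of_notMem_I hsupp (by simp [I])
  have h2 : φ (-(l / 2)) = 0 := eq_zero_of_notMem_I hsupp (by simp [I])
  have hac := (hii.absolutelyContinuousOnInterval_intervalIntegral
    (c := -(l / 2)) Set.left_mem_uIcc).integral_mul_deriv_eq_deriv_mul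
    ((hφ.of_le (by exact_mod_cast le_top)).contDiffOn (s := Set.uIcc (-(l / 2)) (l / 2))
      |>.absolutelyContinuousOnInterval)
  rw [h1, h2, mul_zero, mul_zero, sub_zero, zero_sub] at hac
  rw [setIntegral_I hl, setIntegral_I hl]
  refine hac.trans (congrArg _ (intervalIntegral.integral_congr_ae ?_))
  -- The right end point belongs to the half-open integration interval but not to I, where the
  -- indicator lives.
  have hne : ∀ᵐ x : ℝ, x ≠ l / 2 := by simp [ae_iff, measure_singleton]
  filter_upwards [hii.ae_hasDerivAt_integral, hne] with x hx hxne hxm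
  rw [(hx (Set.uIoc_subset_uIcc hxm) _ Set.left_mem_uIcc).deriv, Set.indicator_of_mem]
  rw [Set.uIoc_of_le (by linarith)] at hxm
  exact ⟨hxm.1, lt_of_le_of_ne hxm.2 hxne⟩

theorem integrable_mul_test {f φ : ℝ → ℝ} (hf : Integrable f (μI l)) (hφ : Continuous φ)
    (hφs : HasCompactSupport φ) : Integrable (fun x => f x * φ x) (μI l) := by
  obtain ⟨C, hC⟩ := hφs.exists_bound_of_continuous hφ
  exact hf.mul_bdd hφ.aestronglyMeasurable (Eventually.of_forall hC)

/-- A function on `I` with vanishing weak derivative is constant. -/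
theorem ae_eq_const_of_integral_mul_deriv_eq_zero (hl : 0 < l) {h : ℝ → ℝ}
    (hh : Integrable h (μI l))
    (H : ∀ φ : ℝ → ℝ, ContDiff ℝ ∞ φ → HasCompactSupport φ → tsupport φ ⊆ I l →
      ∫ x in I l, h x * deriv φ x = 0) :
    ∃ c : ℝ, h =ᵐ[μI l] fun _ => c := by
  -- A normalized bump η supported in I; the constant will be ∫ h η.
  let bump : ContDiffBump (0 : ℝ) := ⟨l / 8, l / 4, by positivity, by linarith⟩
  set η : ℝ → ℝ := bump.normed volume with hη
  have hηc : ContDiff ℝ ∞ η := bump.contDiff_normed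
  have hηs : tsupport η = Metric.closedBall 0 (l / 4) := bump.tsupport_normed_eq
  have hηI : tsupport η ⊆ I l := by
    rw [hηs, Real.closedBall_eq_Icc]
    exact Set.Icc_subset_Ioo (by linarith) (by linarith)
  have hηcs : HasCompactSupport η := bump.hasCompactSupport_normed
  have hη1 : ∫ x, η x = 1 := bump.integral_normed
  refine ⟨∫ x in I l, h x * η x, ?_⟩
  set c := ∫ x in I l, h x * η x with hc
  have key : ∀ᵐ x ∂(μI l), x ∈ I l → h x - c = 0 := by
    refine (isOpen_I l).ae_eq_zero_of_integral_contDiff_smul_eq_zero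
      ((hh.sub (integrable_const c)).locallyIntegrable.locallyIntegrableOn _) ?_
    intro ψ hψ hψs hψI
    set s := ∫ x, ψ x with hs
    have hsI : ∫ x in I l, ψ x = s :=
      setIntegral_eq_integral_of_forall_compl_eq_zero fun x hx => eq_zero_of_notMem_I hψI hx
    -- Du Bois-Reymond's argument: ψ minus its mean times η integrates to zero, so its primitive φ
    -- is an admissible test function with derivative θ.
    let θ : ℝ → ℝ := fun x => ψ x - s * η x
    have hθc : ContDiff ℝ ∞ θ := hψ.sub (contDiff_const.mul hηc)
    have hψint : Integrable ψ := hψ.continuous.integrable_of_hasCompactSupport hψs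
    have hηint : Integrable η := hηc.continuous.integrable_of_hasCompactSupport hηcs
    have hθint : Integrable θ := hψint.sub (hηint.const_mul s)
    have hθ0 : ∫ x, θ x = 0 := by
      rw [integral_sub hψint (hηint.const_mul s), integral_const_mul, hη1, mul_one, sub_self]
    let φ : ℝ → ℝ := fun x => ∫ t in (-(l / 2))..x, θ t
    have hφd : ∀ x, HasDerivAt φ (θ x) x := fun x =>
      intervalIntegral.integral_hasDerivAt_right hθint.intervalIntegrable
        (hθc.continuous.stronglyMeasurableAtFilter _ _) hθc.continuous.continuousAt
    have hφd' : deriv φ = θ := funext fun x => (hφd x).deriv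
    have hφc : ContDiff ℝ ∞ φ :=
      contDiff_infty_iff_deriv.2 ⟨fun x => (hφd x).differentiableAt, by rwa [hφd']⟩
    set K := tsupport ψ ∪ tsupport η with hK
    have hKc : IsCompact K := IsCompact.union hψs hηcs
    have hKne : K.Nonempty :=
      ⟨0, Or.inr (by rw [hηs]; exact Metric.mem_closedBall_self (by positivity))⟩
    have hKI : K ⊆ I l := Set.union_subset hψI hηI
    have ha := hKI (hKc.sInf_mem hKne)
    have hb := hKI (hKc.sSup_mem hKne)
    have hθK : ∀ x, x ∉ Set.Icc (sInf K) (sSup K) → θ x = 0 := by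
      intro x hx
      have hxK : x ∉ K := fun h => hx ⟨csInf_le hKc.bddBelow h, le_csSup hKc.bddAbove h⟩
      have h1 : ψ x = 0 := image_eq_zero_of_notMem_tsupport fun h => hxK (Or.inl h)
      have h2 : η x = 0 := image_eq_zero_of_notMem_tsupport fun h => hxK (Or.inr h)
      simp [θ, h1, h2]
    have hφK : ∀ x, x ∉ Set.Icc (sInf K) (sSup K) → φ x = 0 := by
      intro x hx
      rcases lt_or_ge x (sInf K) with h | h
      · refine intervalIntegral.integral_zero_ae (Eventually.of_forall fun t ht =>
          hθK t fun h' => ?_)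
        have := ha.1
        rcases Set.mem_uIoc.1 ht with h'' | h'' <;> linarith [h'.1]
      -- To the right of the supports the primitive equals the total integral of θ, which is zero.
      · have hx' : sSup K < x := not_le.1 fun h' => hx ⟨h, h'⟩
        have hlx : -(l / 2) < x := hb.1.trans hx'
        change ∫ t in (-(l / 2))..x, θ t = 0
        rw [intervalIntegral.integral_of_le hlx.le, setIntegral_eq_integral_of_forall_compl_eq_zero,
          hθ0]
        intro t ht
        refine hθK t fun h' => ht ⟨ha.1.trans_le h'.1, h'.2.trans hx'.le⟩
    have hφs : tsupport φ ⊆ Set.Icc (sInf K) (sSup K) :=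
      closure_minimal (fun x hx => by_contra fun h' => hx (hφK x h')) isClosed_Icc
    have := H φ hφc (isCompact_Icc.of_isClosed_subset (isClosed_tsupport φ) hφs)
      (hφs.trans (Set.Icc_subset_Ioo ha.1 hb.2))
    rw [hφd'] at this
    have e1 : ∫ x in I l, h x * θ x = (∫ x in I l, h x * ψ x) - s * c := by
      rw [hc, ← integral_const_mul, ← integral_sub (integrable_mul_test hh hψ.continuous hψs)
        ((integrable_mul_test hh hηc.continuous hηcs).const_mul s)]
      congr 1; funext x; simp only [θ]; ring
    have e2 : ∫ x in I l, ψ x • (h x - c) = (∫ x in I l, h x * ψ x) - s * c := by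
      rw [← hsI, ← integral_mul_const, ← integral_sub (integrable_mul_test hh hψ.continuous hψs)
        (hψint.restrict.mul_const c)]
      congr 1; funext x; simp only [smul_eq_mul]; ring
    rw [e2, ← e1, this]
  filter_upwards [key, ae_restrict_mem (measurableSet_I l)] with x hx hxI
  exact sub_eq_zero.1 (hx hxI)

/-- The difference of f and the primitive of g has zero weak derivative, hence is constant. -/
theorem HasWeakDeriv.ae_eq_add_prim (hl : 0 < l) {f g : ℝ → ℝ} (hf : Integrable f (μI l))
    (hg : Integrable g (μI l)) (h : HasWeakDeriv l f g) :
    ∃ c : ℝ, f =ᵐ[μI l] fun x => c + prim l g x := by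
  have hp : Integrable (prim l g) (μI l) := by
    refine (integrable_const (∫ t, |g t| ∂(μI l))).mono'
      (continuous_prim hg).aestronglyMeasurable (Eventually.of_forall fun x => abs_prim_le hg x)
  obtain ⟨c, hc⟩ := ae_eq_const_of_integral_mul_deriv_eq_zero hl (hf.sub hp) fun φ hφ hφs hφI => by
    have hd : Continuous (deriv φ) := hφ.continuous_deriv (by exact_mod_cast le_top)
    have e : ∀ x, (f - prim l g) x * deriv φ x = f x * deriv φ x - prim l g x * deriv φ x :=
      fun x => sub_mul _ _ _
    simp only [e]
    rw [integral_sub (integrable_mul_test hf hd hφs.deriv)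
      (integrable_mul_test hp hd hφs.deriv), h φ hφ hφs hφI,
      hasWeakDeriv_prim hl hg φ hφ hφs hφI, sub_self]
  refine ⟨c, ?_⟩
  filter_upwards [hc] with x hx
  have : f x - prim l g x = c := hx
  linarith

theorem HasWeakDeriv.congr {f f' g g' : ℝ → ℝ} (h : HasWeakDeriv l f g) (hf : f' =ᵐ[μI l] f)
    (hg : g' =ᵐ[μI l] g) : HasWeakDeriv l f' g' := by
  intro φ h1 h2 h3
  have e1 : ∫ x in I l, f' x * deriv φ x = ∫ x in I l, f x * deriv φ x :=
    integral_congr_ae (hf.mul EventuallyEq.rfl)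
  have e2 : ∫ x in I l, g' x * φ x = ∫ x in I l, g x * φ x :=
    integral_congr_ae (hg.mul EventuallyEq.rfl)
  rw [e1, e2, h φ h1 h2 h3]

theorem HasWeakDeriv.add {f f' g g' : ℝ → ℝ} (h : HasWeakDeriv l f g) (h' : HasWeakDeriv l f' g')
    (hf : Integrable f (μI l)) (hf' : Integrable f' (μI l)) (hg : Integrable g (μI l))
    (hg' : Integrable g' (μI l)) :
    HasWeakDeriv l (fun x => f x + f' x) (fun x => g x + g' x) := by
  intro φ h1 h2 h3
  have hd : Continuous (deriv φ) := h1.continuous_deriv (by exact_mod_cast le_top)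
  simp only [add_mul]
  rw [integral_add (integrable_mul_test hf hd h2.deriv) (integrable_mul_test hf' hd h2.deriv),
    integral_add (integrable_mul_test hg h1.continuous h2)
      (integrable_mul_test hg' h1.continuous h2), h φ h1 h2 h3, h' φ h1 h2 h3, neg_add]

end WeakDeriv

/-! ### Boundary values -/

section Trace

variable {l : ℝ}

/-- Continuous functions on the closed interval that agree almost everywhere agree at the end points
too, so the trace can be read off any continuous representative. -/
theorem HasTrace.eq_of_ae_eq (hl : 0 < l) {f F : ℝ → ℝ} {a b : ℝ} (h : HasTrace l f a b)
    (hF : Continuous F) (hfF : f =ᵐ[μI l] F) : a = F (-(l / 2)) ∧ b = F (l / 2) := by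
  obtain ⟨F', hF', hae, rfl, rfl⟩ := h
  have hlt : -(l / 2) < l / 2 := by linarith
  have key : Set.EqOn F' F (Set.Icc (-(l / 2)) (l / 2)) := by
    refine Measure.eqOn_Icc_of_ae_eq volume hlt.ne ?_ hF' hF.continuousOn
    rw [Measure.restrict_congr_set Ioo_ae_eq_Icc.symm]
    exact hae.trans hfF
  exact ⟨key (Set.left_mem_Icc.2 hlt.le), key (Set.right_mem_Icc.2 hlt.le)⟩

theorem hasTrace_of_ae_eq {f F : ℝ → ℝ} (hF : Continuous F) (hfF : f =ᵐ[μI l] F) :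
    HasTrace l f (F (-(l / 2))) (F (l / 2)) :=
  ⟨F, hF.continuousOn, hfF.symm, rfl, rfl⟩

/-- Two Sobolev functions have the same trace iff their difference is the primitive of the
difference of their derivatives and the latter has mean zero. -/
theorem sameTrace_iff (hl : 0 < l) {f f' g g' : Lp ℝ 2 (μI l)} (h : HasWeakDeriv l f g)
    (h' : HasWeakDeriv l f' g') :
    SameTrace l f f' ↔ f - f' = primLp l (g - g') ∧ primEval l (l / 2) (g - g') = 0 := by
  obtain ⟨c, hc⟩ := h.ae_eq_add_prim hl (integrable_coe f) (integrable_coe g)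
  obtain ⟨c', hc'⟩ := h'.ae_eq_add_prim hl (integrable_coe f') (integrable_coe g')
  have hF : Continuous fun x => c + prim l g x :=
    continuous_const.add (continuous_prim (integrable_coe g))
  have hF' : Continuous fun x => c' + prim l g' x :=
    continuous_const.add (continuous_prim (integrable_coe g'))
  have hsub : ∀ᵐ x ∂(μI l), (f - f' : Lp ℝ 2 (μI l)) x - primLp l (g - g') x = c - c' := by
    filter_upwards [hc, hc', Lp.coeFn_sub f f', coeFn_primLp (g - g')] with x h1 h2 h3 h4
    rw [h4, h3, Pi.sub_apply, h1, h2]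
    have := map_sub (primEval l x) g g'
    simp only [primEval_apply] at this
    rw [this]; ring
  constructor
  · rintro ⟨a, b, h1, h2⟩
    obtain ⟨ha, hb⟩ := h1.eq_of_ae_eq hl hF hc
    obtain ⟨ha', hb'⟩ := h2.eq_of_ae_eq hl hF' hc'
    rw [prim_left, add_zero] at ha ha'
    refine ⟨?_, ?_⟩
    · ext1
      filter_upwards [hsub] with x hx
      rw [← ha, ← ha', sub_self] at hx
      linarith
    · rw [map_sub, primEval_apply, primEval_apply]
      linarith
  · rintro ⟨h1, h2⟩
    have hcc : c = c' := by
      -- I has positive measure, so the almost-everywhere identity between constants holds at some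
      -- point.
      have hne : (ae (μI l)).NeBot := by
        rw [ae_neBot, Ne, Measure.restrict_eq_zero, I, Real.volume_Ioo]
        simp [hl]
      obtain ⟨x, hx⟩ := hsub.exists
      rw [h1, sub_self] at hx
      linarith
    refine ⟨_, _, hasTrace_of_ae_eq hF hc, ?_⟩
    rw [map_sub, primEval_apply, primEval_apply, sub_eq_zero] at h2
    have := hasTrace_of_ae_eq hF' hc'
    simp only [prim_left] at this ⊢
    rwa [h2, hcc]

/-- Relative to a reference f₁ with the prescribed boundary values, the affine boundary condition
becomes a linear condition on the increment, free of the boundary data. -/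
theorem sameTrace_trans_iff (hl : 0 < l) {f₁ f₂ f₃ g₁ g₂ g₃ : Lp ℝ 2 (μI l)}
    (h₁ : HasWeakDeriv l f₁ g₁) (h₂ : HasWeakDeriv l f₂ g₂) (h₃ : HasWeakDeriv l f₃ g₃)
    (h : SameTrace l f₁ f₃) :
    SameTrace l f₂ f₃ ↔ f₂ - f₁ = primLp l (g₂ - g₁) ∧ primEval l (l / 2) (g₂ - g₁) = 0 := by
  rw [sameTrace_iff hl h₁ h₃] at h
  rw [sameTrace_iff hl h₂ h₃]
  have e : f₂ - f₃ = (f₂ - f₁) + (f₁ - f₃) := by abel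
  have e' : g₂ - g₃ = (g₂ - g₁) + (g₁ - g₃) := by abel
  rw [e, e', map_add, map_add, h.1, h.2, add_zero, add_left_inj]

theorem hasWeakDeriv_primLp (hl : 0 < l) (g : Lp ℝ 2 (μI l)) : HasWeakDeriv l (primLp l g) g :=
  (hasWeakDeriv_prim hl (integrable_coe g)).congr (coeFn_primLp g) EventuallyEq.rfl

theorem HasWeakDeriv.add_Lp {f f' g g' : Lp ℝ 2 (μI l)} (h : HasWeakDeriv l f g)
    (h' : HasWeakDeriv l f' g') :
    HasWeakDeriv l (f + f' : Lp ℝ 2 (μI l)) (g + g' : Lp ℝ 2 (μI l)) :=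
  (h.add h' (integrable_coe f) (integrable_coe f') (integrable_coe g) (integrable_coe g')).congr
    (Lp.coeFn_add f f') (Lp.coeFn_add g g')

/-- Weakly differentiable functions on `I` are essentially bounded. -/
theorem HasWeakDeriv.memLp_top (hl : 0 < l) {f g : Lp ℝ 2 (μI l)} (h : HasWeakDeriv l f g) :
    MemLp f ∞ (μI l) := by
  obtain ⟨c, hc⟩ := h.ae_eq_add_prim hl (integrable_coe f) (integrable_coe g)
  obtain ⟨C, -, hC⟩ := exists_abs_prim_le l
  refine memLp_top_of_bound (Lp.aestronglyMeasurable f) (|c| + C * ‖g‖) ?_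
  filter_upwards [hc] with x hx
  rw [hx]
  exact (abs_add_le _ _).trans (by gcongr; exact hC g x)

end Trace

/-! ### Multiplication operators and vector-valued L² functions -/

section Multiplication

variable {α : Type*} [MeasurableSpace α] {μ : Measure α}

theorem ae_norm_mul_le {m : α → ℝ} (hm : MemLp m ∞ μ) (f : α → ℝ) :
    ∀ᵐ x ∂μ, ‖m x * f x‖ ≤ (eLpNorm m ∞ μ).toReal * ‖f x‖ := by
  filter_upwards [ae_le_eLpNormEssSup (f := m) (μ := μ)] with x hx
  rw [norm_mul]
  gcongr
  rw [← eLpNorm_exponent_top] at hx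
  simpa using ENNReal.toReal_mono hm.2.ne hx

theorem memLp_mul_coe {m : α → ℝ} (hm : MemLp m ∞ μ) (f : Lp ℝ 2 μ) :
    MemLp (fun x => m x * f x) 2 μ :=
  (Lp.memLp f).of_le_mul (hm.1.mul (Lp.aestronglyMeasurable f)) (ae_norm_mul_le hm f)

/-- Multiplication by an essentially bounded function on `L²`. -/
def mulBdd (m : α → ℝ) (hm : MemLp m ∞ μ) : Lp ℝ 2 μ →L[ℝ] Lp ℝ 2 μ :=
  LinearMap.mkContinuousOfExistsBound
    { toFun := fun f => (memLp_mul_coe hm f).toLp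
      map_add' := fun f g => by
        rw [← MemLp.toLp_add, MemLp.toLp_eq_toLp_iff]
        filter_upwards [Lp.coeFn_add f g] with x hx
        rw [hx]
        exact mul_add _ _ _
      map_smul' := fun c f => by
        rw [← MemLp.toLp_const_smul, MemLp.toLp_eq_toLp_iff]
        filter_upwards [Lp.coeFn_smul c f] with x hx
        rw [hx]
        exact mul_left_comm _ _ _ }
    (by
      refine ⟨(eLpNorm m ∞ μ).toReal, fun f => Lp.norm_le_mul_norm_of_ae_le_mul ?_⟩
      filter_upwards [(memLp_mul_coe hm f).coeFn_toLp, ae_norm_mul_le hm f] with x hx hx'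
      exact (congrArg _ hx).trans_le hx')

theorem coeFn_mulBdd {m : α → ℝ} (hm : MemLp m ∞ μ) (f : Lp ℝ 2 μ) :
    mulBdd m hm f =ᵐ[μ] fun x => m x * f x :=
  (memLp_mul_coe hm f).coeFn_toLp

/-- The map `f ↦ f • e_i` from scalar to vector valued functions. -/
def singleLp (μ : Measure α) (i : Fin 3) : Lp ℝ 2 μ →L[ℝ] Lp E3 2 μ :=
  ((ContinuousLinearMap.id ℝ ℝ).smulRight (EuclideanSpace.single i (1 : ℝ) : E3)).compLpL 2 μ

/-- A vector valued function with given components. -/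
def vecLp (μ : Measure α) : Lp ℝ 2 μ × Lp ℝ 2 μ × Lp ℝ 2 μ →L[ℝ] Lp E3 2 μ :=
  (singleLp μ 0).comp (ContinuousLinearMap.fst ℝ _ _) +
    (singleLp μ 1).comp ((ContinuousLinearMap.fst ℝ _ _).comp (ContinuousLinearMap.snd ℝ _ _)) +
    (singleLp μ 2).comp ((ContinuousLinearMap.snd ℝ _ _).comp (ContinuousLinearMap.snd ℝ _ _))

theorem vecLp_apply (f : Lp ℝ 2 μ × Lp ℝ 2 μ × Lp ℝ 2 μ) :
    vecLp μ f = singleLp μ 0 f.1 + singleLp μ 1 f.2.1 + singleLp μ 2 f.2.2 := rfl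

theorem coeFn_vecLp (f : Lp ℝ 2 μ × Lp ℝ 2 μ × Lp ℝ 2 μ) :
    vecLp μ f =ᵐ[μ] fun x => !₂[f.1 x, f.2.1 x, f.2.2 x] := by
  have h : ∀ (i : Fin 3) (g : Lp ℝ 2 μ), singleLp μ i g =ᵐ[μ] fun x =>
      g x • (EuclideanSpace.single i (1 : ℝ) : E3) := fun i g =>
    ContinuousLinearMap.coeFn_compLpL _ _
  filter_upwards [h 0 f.1, h 1 f.2.1, h 2 f.2.2,
    Lp.coeFn_add (singleLp μ 0 f.1 + singleLp μ 1 f.2.1) (singleLp μ 2 f.2.2),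
    Lp.coeFn_add (singleLp μ 0 f.1) (singleLp μ 1 f.2.1)] with x h1 h2 h3 h4 h5
  rw [vecLp_apply, h4, Pi.add_apply, h5, Pi.add_apply, h1, h2, h3]
  ext i
  fin_cases i <;> simp

theorem norm_le_norm_vecLp (f : Lp ℝ 2 μ × Lp ℝ 2 μ × Lp ℝ 2 μ) :
    ‖f.1‖ ≤ ‖vecLp μ f‖ ∧ ‖f.2.1‖ ≤ ‖vecLp μ f‖ ∧ ‖f.2.2‖ ≤ ‖vecLp μ f‖ := by
  refine ⟨?_, ?_, ?_⟩ <;> refine Lp.norm_le_norm_of_ae_le ?_ <;>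
    filter_upwards [coeFn_vecLp f] with x hx <;> rw [hx]
  · exact PiLp.norm_apply_le (!₂[f.1 x, f.2.1 x, f.2.2 x] : E3) 0
  · exact PiLp.norm_apply_le (!₂[f.1 x, f.2.1 x, f.2.2 x] : E3) 1
  · exact PiLp.norm_apply_le (!₂[f.1 x, f.2.1 x, f.2.2 x] : E3) 2

end Multiplication

/-! ### L² on the rectangle and the Bernoulli-Navier strain -/

section Rectangle

variable {l : ℝ}

/-- Lebesgue measure on `(-1/2, 1/2)`. -/
abbrev μJ : Measure ℝ := volume.restrict (Set.Ioo (-(1 / 2)) (1 / 2))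

theorem μS_eq_prod (l : ℝ) : μS l = (μI l).prod μJ := by
  rw [μS, S, Measure.volume_eq_prod, Measure.prod_restrict]

instance : IsProbabilityMeasure μJ :=
  ⟨by rw [Measure.restrict_apply_univ, Real.volume_Ioo]; norm_num⟩

instance (l : ℝ) : IsFiniteMeasure (μS l) := by rw [μS_eq_prod]; infer_instance

theorem measurePreserving_fst_μS (l : ℝ) : MeasurePreserving Prod.fst (μS l) (μI l) := by
  rw [μS_eq_prod]; exact measurePreserving_fst

theorem ae_fst {p : ℝ → Prop} (h : ∀ᵐ x ∂(μI l), p x) : ∀ᵐ x ∂(μS l), p x.1 :=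
  (measurePreserving_fst_μS l).quasiMeasurePreserving.ae h

/-- Functions on `I` as functions on `S` independent of `x₂`. -/
def fstLp (l : ℝ) : Lp ℝ 2 (μI l) →ₗᵢ[ℝ] Lp ℝ 2 (μS l) :=
  Lp.compMeasurePreservingₗᵢ ℝ Prod.fst (measurePreserving_fst_μS l)

theorem coeFn_fstLp (f : Lp ℝ 2 (μI l)) : fstLp l f =ᵐ[μS l] fun x => f x.1 :=
  Lp.coeFn_compMeasurePreserving f (measurePreserving_fst_μS l)

theorem measurableSet_S (l : ℝ) : MeasurableSet (S l) := measurableSet_Ioo.prod measurableSet_Ioo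

theorem isOpen_S (l : ℝ) : IsOpen (S l) := isOpen_Ioo.prod isOpen_Ioo

theorem memLp_snd (l : ℝ) : MemLp (fun x : ℝ × ℝ => x.2) ∞ (μS l) := by
  refine memLp_top_of_bound continuous_snd.aestronglyMeasurable 1 ?_
  filter_upwards [ae_restrict_mem (measurableSet_S l)] with x hx
  have := hx.2
  rw [Real.norm_eq_abs, abs_le]
  constructor <;> linarith [this.1, this.2]

/-- The function `x₂ f(x₁)` on `S`. -/
def sndFstLp (l : ℝ) : Lp ℝ 2 (μI l) →L[ℝ] Lp ℝ 2 (μS l) :=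
  (mulBdd _ (memLp_snd l)).comp (fstLp l).toContinuousLinearMap

theorem coeFn_sndFstLp (f : Lp ℝ 2 (μI l)) : sndFstLp l f =ᵐ[μS l] fun x => x.2 * f x.1 := by
  filter_upwards [coeFn_mulBdd (memLp_snd l) (fstLp l f), coeFn_fstLp f] with x h1 h2
  exact h1.trans (by rw [h2])

/-- Fubini reduces this to the vanishing mean of x₂ over the cross-section. -/
theorem inner_fstLp_sndFstLp (f g : Lp ℝ 2 (μI l)) :
    inner ℝ (fstLp l f) (sndFstLp l g) = 0 := by
  have hJ : ∫ t, t ∂μJ = 0 := by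
    rw [← integral_Ioc_eq_integral_Ioo, ← intervalIntegral.integral_of_le (by norm_num),
      integral_id]
    norm_num
  have : ∀ᵐ x ∂(μS l), inner ℝ (fstLp l f x) (sndFstLp l g x) = (g x.1 * f x.1) * x.2 := by
    filter_upwards [coeFn_fstLp f, coeFn_sndFstLp g] with x h1 h2
    rw [h1, h2, RCLike.inner_apply, conj_trivial]; ring
  rw [L2.inner_def, integral_congr_ae this, μS_eq_prod,
    integral_prod_mul (fun x => g x * f x) (fun t => t), hJ, mul_zero]

theorem norm_sndFstLp_sq (f : Lp ℝ 2 (μI l)) : ‖sndFstLp l f‖ ^ 2 = ‖f‖ ^ 2 / 12 := by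
  have hJ : ∫ t, t ^ 2 ∂μJ = 1 / 12 := by
    rw [← integral_Ioc_eq_integral_Ioo, ← intervalIntegral.integral_of_le (by norm_num),
      integral_pow]
    norm_num
  have : ∀ᵐ x ∂(μS l), inner ℝ (sndFstLp l f x) (sndFstLp l f x) = (f x.1 * f x.1) * x.2 ^ 2 := by
    filter_upwards [coeFn_sndFstLp f] with x h2
    rw [h2, RCLike.inner_apply, conj_trivial]; ring
  rw [← real_inner_self_eq_norm_sq, ← real_inner_self_eq_norm_sq, L2.inner_def, L2.inner_def,
    integral_congr_ae this, μS_eq_prod, integral_prod_mul (fun x => f x * f x) (fun t => t ^ 2), hJ]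
  simp only [RCLike.inner_apply, conj_trivial]
  ring

/-- The bending-stretching strain `α(x₁) - x₂ β(x₁)`. -/
def strainLp (l : ℝ) : Lp ℝ 2 (μI l) × Lp ℝ 2 (μI l) →L[ℝ] Lp ℝ 2 (μS l) :=
  (fstLp l).toContinuousLinearMap.comp (ContinuousLinearMap.fst ℝ _ _) -
    (sndFstLp l).comp (ContinuousLinearMap.snd ℝ _ _)

theorem strainLp_apply (a b : Lp ℝ 2 (μI l)) :
    strainLp l (a, b) = fstLp l a - sndFstLp l b := rfl

theorem norm_strainLp_sq (a b : Lp ℝ 2 (μI l)) :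
    ‖strainLp l (a, b)‖ ^ 2 = ‖a‖ ^ 2 + ‖b‖ ^ 2 / 12 := by
  rw [strainLp_apply, norm_sub_sq_real, inner_fstLp_sndFstLp, norm_sndFstLp_sq,
    LinearIsometry.norm_map]
  ring

/-- Stretching and bending are orthogonal, so each is recovered from the strain; 4 is a convenient
bound for √12. -/
theorem norm_le_norm_strainLp (a b : Lp ℝ 2 (μI l)) :
    ‖a‖ ≤ ‖strainLp l (a, b)‖ ∧ ‖b‖ ≤ 4 * ‖strainLp l (a, b)‖ := by
  have h := norm_strainLp_sq a b
  constructor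
  · exact abs_le_of_sq_le_sq' (by nlinarith [sq_nonneg ‖b‖]) (norm_nonneg _) |>.2
  · exact abs_le_of_sq_le_sq' (by nlinarith [sq_nonneg ‖a‖, sq_nonneg ‖b‖]) (by positivity) |>.2

end Rectangle

/-! ### Weak partial derivatives on the rectangle -/

section WeakPartial

variable {l : ℝ}

theorem integrable_coe_S (f : Lp ℝ 2 (μS l)) : Integrable f (μS l) :=
  (Lp.memLp f).integrable one_le_two

theorem integrable_mul_test_S {f φ : ℝ × ℝ → ℝ} (hf : Integrable f (μS l)) (hφ : Continuous φ)
    (hφs : HasCompactSupport φ) : Integrable (fun x => f x * φ x) (μS l) := by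
  obtain ⟨C, hC⟩ := hφs.exists_bound_of_continuous hφ
  exact hf.mul_bdd hφ.aestronglyMeasurable (Eventually.of_forall hC)

theorem continuous_fderiv_apply_test {φ : ℝ × ℝ → ℝ} (hφ : ContDiff ℝ ∞ φ) (v : ℝ × ℝ) :
    Continuous fun x => fderiv ℝ φ x v :=
  (hφ.continuous_fderiv (by simp)).clm_apply continuous_const

theorem HasWeakPartial.congr {v : ℝ × ℝ} {f f' g g' : ℝ × ℝ → ℝ} (h : HasWeakPartial l v f g)
    (hf : f' =ᵐ[μS l] f) (hg : g' =ᵐ[μS l] g) : HasWeakPartial l v f' g' := by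
  intro φ h1 h2 h3
  have e1 : ∫ x in S l, f' x * fderiv ℝ φ x v = ∫ x in S l, f x * fderiv ℝ φ x v :=
    integral_congr_ae (hf.mul EventuallyEq.rfl)
  have e2 : ∫ x in S l, g' x * φ x = ∫ x in S l, g x * φ x :=
    integral_congr_ae (hg.mul EventuallyEq.rfl)
  rw [e1, e2, h φ h1 h2 h3]

theorem HasWeakPartial.add_Lp {v : ℝ × ℝ} {f f' g g' : Lp ℝ 2 (μS l)}
    (h : HasWeakPartial l v f g) (h' : HasWeakPartial l v f' g') :
    HasWeakPartial l v (f + f' : Lp ℝ 2 (μS l)) (g + g' : Lp ℝ 2 (μS l)) := by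
  refine HasWeakPartial.congr (f := fun x => f x + f' x) (g := fun x => g x + g' x) ?_
    (Lp.coeFn_add f f') (Lp.coeFn_add g g')
  intro φ h1 h2 h3
  have hd := continuous_fderiv_apply_test h1 v
  have hds : HasCompactSupport fun x => fderiv ℝ φ x v := h2.fderiv_apply ℝ v
  simp only [add_mul]
  rw [integral_add (integrable_mul_test_S (integrable_coe_S f) hd hds)
      (integrable_mul_test_S (integrable_coe_S f') hd hds),
    integral_add (integrable_mul_test_S (integrable_coe_S g) h1.continuous h2)
      (integrable_mul_test_S (integrable_coe_S g') h1.continuous h2), h φ h1 h2 h3, h' φ h1 h2 h3,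
    neg_add]

theorem HasWeakPartial.neg_Lp {v : ℝ × ℝ} {f g : Lp ℝ 2 (μS l)} (h : HasWeakPartial l v f g) :
    HasWeakPartial l v (-f : Lp ℝ 2 (μS l)) (-g : Lp ℝ 2 (μS l)) := by
  refine HasWeakPartial.congr (f := fun x => -f x) (g := fun x => -g x) ?_
    (Lp.coeFn_neg f) (Lp.coeFn_neg g)
  intro φ h1 h2 h3
  simp only [neg_mul, integral_neg]
  rw [h φ h1 h2 h3]

/-- The fundamental lemma of the calculus of variations. It makes the derivative fields of a `W12S`
element functions of `fn`. -/
theorem HasWeakPartial.unique {v : ℝ × ℝ} {f g g' : Lp ℝ 2 (μS l)} (h : HasWeakPartial l v f g)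
    (h' : HasWeakPartial l v f g') : g = g' := by
  have key : ∀ᵐ x ∂(μS l), x ∈ S l → g x - g' x = 0 := by
    refine (isOpen_S l).ae_eq_zero_of_integral_contDiff_smul_eq_zero
      (((integrable_coe_S g).sub (integrable_coe_S g')).locallyIntegrable.locallyIntegrableOn _) ?_
    intro φ h1 h2 h3
    have e : ∀ x, φ x • (g x - g' x) = g x * φ x - g' x * φ x := fun x => by
      rw [smul_eq_mul]; ring
    simp only [e]
    rw [integral_sub (integrable_mul_test_S (integrable_coe_S g) h1.continuous h2)
      (integrable_mul_test_S (integrable_coe_S g') h1.continuous h2)]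
    have h4 := h φ h1 h2 h3
    have h5 := h' φ h1 h2 h3
    linarith
  ext1
  filter_upwards [key, ae_restrict_mem (measurableSet_S l)] with x hx hxS
  exact sub_eq_zero.1 (hx hxS)

theorem hasDerivAt_slice_fst {φ : ℝ × ℝ → ℝ} (hφ : ContDiff ℝ ∞ φ) (x y : ℝ) :
    HasDerivAt (fun x => φ (x, y)) (fderiv ℝ φ (x, y) (1, 0)) x :=
  ((hφ.differentiable (by simp)) (x, y)).hasFDerivAt.comp_hasDerivAt x
    ((hasDerivAt_id x).prodMk (hasDerivAt_const x y))

theorem hasDerivAt_slice_snd {φ : ℝ × ℝ → ℝ} (hφ : ContDiff ℝ ∞ φ) (x y : ℝ) :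
    HasDerivAt (fun y => φ (x, y)) (fderiv ℝ φ (x, y) (0, 1)) y :=
  ((hφ.differentiable (by simp)) (x, y)).hasFDerivAt.comp_hasDerivAt y
    ((hasDerivAt_const y x).prodMk (hasDerivAt_id y))

variable {f g q q' : ℝ → ℝ}

theorem integrable_mul_prod (hf : Integrable f (μI l)) (hq : Continuous q) :
    Integrable (fun x : ℝ × ℝ => f x.1 * q x.2) (μS l) := by
  rw [μS_eq_prod]
  refine hf.mul_prod ?_
  exact (hq.continuousOn.integrableOn_Icc).mono_set Set.Ioo_subset_Icc_self

/-- By Fubini, since each horizontal slice of a test function on S is a test function on I. -/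
theorem HasWeakDeriv.hasWeakPartial_fst (h : HasWeakDeriv l f g) (hf : Integrable f (μI l))
    (hg : Integrable g (μI l)) (hq : Continuous q) :
    HasWeakPartial l (1, 0) (fun x => f x.1 * q x.2) (fun x => g x.1 * q x.2) := by
  intro φ hφ hφs hφS
  have i1 := integrable_mul_test_S (integrable_mul_prod hf hq)
    (continuous_fderiv_apply_test hφ (1, 0)) (hφs.fderiv_apply ℝ (1, 0))
  have i2 := integrable_mul_test_S (integrable_mul_prod hg hq) hφ.continuous hφs
  rw [μS_eq_prod] at i1 i2
  rw [show (volume.restrict (S l) : Measure (ℝ × ℝ)) = (μI l).prod μJ from μS_eq_prod l,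
    integral_prod_symm _ i1, integral_prod_symm _ i2, ← integral_neg]
  refine integral_congr_ae (Eventually.of_forall fun y => ?_)
  have hemb : Topology.IsClosedEmbedding (fun x : ℝ => (x, y)) :=
    Function.LeftInverse.isClosedEmbedding (f := Prod.fst) (fun _ => rfl) continuous_fst
      (by fun_prop)
  have hc : ContDiff ℝ ∞ fun x => φ (x, y) := hφ.comp (contDiff_id.prodMk contDiff_const)
  have hs : tsupport (fun x => φ (x, y)) ⊆ I l := fun x hx =>
    (hφS (tsupport_comp_subset_preimage φ hemb.continuous hx)).1
  have := h _ hc (hφs.comp_isClosedEmbedding hemb) hs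
  simp only [(hasDerivAt_slice_fst hφ _ y).deriv] at this
  calc ∫ x, f x * q y * fderiv ℝ φ (x, y) (1, 0) ∂(μI l)
      = q y * ∫ x, f x * fderiv ℝ φ (x, y) (1, 0) ∂(μI l) := by
        rw [← integral_const_mul]; congr 1; funext x; ring
    _ = -(q y * ∫ x, g x * φ (x, y) ∂(μI l)) := by rw [this, mul_neg]
    _ = _ := by rw [← integral_const_mul]; congr 2; funext x; ring

/-- Classical integration by parts on vertical slices, where test functions vanish at ±1/2. -/
theorem hasWeakPartial_snd (hf : Integrable f (μI l)) (hq : ∀ t, HasDerivAt q (q' t) t)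
    (hq' : Continuous q') :
    HasWeakPartial l (0, 1) (fun x => f x.1 * q x.2) (fun x => f x.1 * q' x.2) := by
  intro φ hφ hφs hφS
  have hqc : Continuous q := continuous_iff_continuousAt.2 fun t => (hq t).continuousAt
  have i1 := integrable_mul_test_S (integrable_mul_prod hf hqc)
    (continuous_fderiv_apply_test hφ (0, 1)) (hφs.fderiv_apply ℝ (0, 1))
  have i2 := integrable_mul_test_S (integrable_mul_prod hf hq') hφ.continuous hφs
  rw [μS_eq_prod] at i1 i2
  rw [show (volume.restrict (S l) : Measure (ℝ × ℝ)) = (μI l).prod μJ from μS_eq_prod l,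
    integral_prod _ i1, integral_prod _ i2, ← integral_neg]
  refine integral_congr_ae (Eventually.of_forall fun x => ?_)
  have h0 : ∀ y, y ∉ Set.Ioo (-(1 / 2) : ℝ) (1 / 2) → φ (x, y) = 0 := fun y hy =>
    image_eq_zero_of_notMem_tsupport fun h => hy (hφS h).2
  have hd : Continuous fun y => fderiv ℝ φ (x, y) (0, 1) :=
    (continuous_fderiv_apply_test hφ (0, 1)).comp (by fun_prop)
  have hparts := intervalIntegral.integral_mul_deriv_eq_deriv_mul (a := -(1 / 2)) (b := 1 / 2)
    (fun y _ => hq y) (fun y _ => hasDerivAt_slice_snd hφ x y)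
    (hq'.intervalIntegrable _ _) (hd.intervalIntegrable _ _)
  rw [h0 (1 / 2) (by simp), h0 (-(1 / 2)) (by simp), mul_zero, mul_zero, sub_zero, zero_sub,
    intervalIntegral.integral_of_le (by norm_num), intervalIntegral.integral_of_le (by norm_num),
    integral_Ioc_eq_integral_Ioo, integral_Ioc_eq_integral_Ioo] at hparts
  calc ∫ y, f x * q y * fderiv ℝ φ (x, y) (0, 1) ∂μJ
      = f x * ∫ y, q y * fderiv ℝ φ (x, y) (0, 1) ∂μJ := by
        rw [← integral_const_mul]; congr 1; funext x; ring
    _ = -(f x * ∫ y, q' y * φ (x, y) ∂μJ) := by rw [hparts, mul_neg]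
    _ = _ := by rw [← integral_const_mul]; congr 2; funext x; ring

end WeakPartial

/-! ### Bernoulli-Navier functions -/

section BernoulliNavier

variable {l : ℝ}

theorem HasWeakDeriv.fstLp {f g : Lp ℝ 2 (μI l)} (h : HasWeakDeriv l f g) :
    HasWeakPartial l (1, 0) (fstLp l f) (fstLp l g) := by
  refine (h.hasWeakPartial_fst (integrable_coe f) (integrable_coe g)
    (continuous_const (y := 1))).congr ?_ ?_
  · simpa using coeFn_fstLp f
  · simpa using coeFn_fstLp g

theorem HasWeakDeriv.sndFstLp {f g : Lp ℝ 2 (μI l)} (h : HasWeakDeriv l f g) :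
    HasWeakPartial l (1, 0) (sndFstLp l f) (sndFstLp l g) := by
  refine (h.hasWeakPartial_fst (integrable_coe f) (integrable_coe g) continuous_id).congr ?_ ?_
  · simpa only [mul_comm, id] using coeFn_sndFstLp f
  · simpa only [mul_comm, id] using coeFn_sndFstLp g

theorem hasWeakPartial_snd_fstLp (f : Lp ℝ 2 (μI l)) :
    HasWeakPartial l (0, 1) (fstLp l f) (0 : Lp ℝ 2 (μS l)) := by
  refine (hasWeakPartial_snd (integrable_coe f) (fun t => hasDerivAt_const t (1 : ℝ))
    continuous_const).congr ?_ ?_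
  · simpa using coeFn_fstLp f
  · filter_upwards [Lp.coeFn_zero ℝ 2 (μS l)] with x hx using hx.trans (mul_zero _).symm

theorem hasWeakPartial_snd_sndFstLp (f : Lp ℝ 2 (μI l)) :
    HasWeakPartial l (0, 1) (sndFstLp l f) (fstLp l f) := by
  refine (hasWeakPartial_snd (integrable_coe f) (fun t => hasDerivAt_id t)
    continuous_const).congr ?_ ?_
  · simpa only [mul_comm, id] using coeFn_sndFstLp f
  · simpa using coeFn_fstLp f

theorem HasWeakDeriv.strainLp {f g f' g' : Lp ℝ 2 (μI l)} (h : HasWeakDeriv l f g)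
    (h' : HasWeakDeriv l f' g') :
    HasWeakPartial l (1, 0) (strainLp l (f, f')) (strainLp l (g, g')) := by
  rw [strainLp_apply, strainLp_apply, sub_eq_add_neg, sub_eq_add_neg]
  exact h.fstLp.add_Lp h'.sndFstLp.neg_Lp

theorem hasWeakPartial_snd_strainLp (f f' : Lp ℝ 2 (μI l)) :
    HasWeakPartial l (0, 1) (strainLp l (f, f')) (-fstLp l f' : Lp ℝ 2 (μS l)) := by
  have := (hasWeakPartial_snd_fstLp f).add_Lp (hasWeakPartial_snd_sndFstLp f').neg_Lp
  rwa [zero_add, ← sub_eq_add_neg, ← strainLp_apply] at this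

theorem coeFn_strainLp (f f' : Lp ℝ 2 (μI l)) :
    strainLp l (f, f') =ᵐ[μS l] fun x => f x.1 - x.2 * f' x.1 := by
  rw [strainLp_apply]
  filter_upwards [Lp.coeFn_sub (fstLp l f) (sndFstLp l f'), coeFn_fstLp f, coeFn_sndFstLp f']
    with x h1 h2 h3
  rw [h1, Pi.sub_apply, h2, h3]

theorem isBN_iff {bu₁ : W12 l} {bu₂ : W22 l} {y₁ y₂ : W12S l} :
    IsBN bu₁ bu₂ y₁ y₂ ↔ ∃ (ξ₁ : W12 l) (ξ₂ : W22 l), bu₁.InBdry ξ₁ ∧ bu₂.InBdry ξ₂ ∧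
      y₁.fn = strainLp l (ξ₁.fn, ξ₂.d1) ∧ y₂.fn = fstLp l ξ₂.fn := by
  refine exists_congr fun ξ₁ => exists_congr fun ξ₂ => and_congr_right fun _ =>
    and_congr_right fun _ => and_congr ?_ ?_
  · rw [Lp.ext_iff]
    exact ⟨fun h => h.trans (coeFn_strainLp _ _).symm, fun h => h.trans (coeFn_strainLp _ _)⟩
  · rw [Lp.ext_iff]
    exact ⟨fun h => h.trans (coeFn_fstLp _).symm, fun h => h.trans (coeFn_fstLp _)⟩

theorem W12S.ext_fn {y z : W12S l} (h : y.fn = z.fn) : y = z := by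
  obtain ⟨f, d1, d2, h1, h2⟩ := y
  obtain ⟨f', d1', d2', h1', h2'⟩ := z
  obtain rfl : f = f' := h
  obtain rfl := h1.unique h1'
  obtain rfl := h2.unique h2'
  rfl

end BernoulliNavier

/-! ### Admissible increments through their highest derivatives -/

section Increments

variable {l : ℝ}

/-- Quadruples of functions in `L²(I)`. -/
abbrev Quad (l : ℝ) : Type :=
  (Lp ℝ 2 (μI l) × Lp ℝ 2 (μI l)) × Lp ℝ 2 (μI l) × Lp ℝ 2 (μI l)

/-- The highest derivatives `(ξ₁', ξ₂'', w'', θ')` of admissible increments: they have mean zero,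
and so do the primitives of the second and third. -/
def incr (l : ℝ) : Submodule ℝ (Quad l) where
  carrier := {k | primEval l (l / 2) k.1.1 = 0 ∧ primEval l (l / 2) k.1.2 = 0 ∧
    primEval l (l / 2) (primLp l k.1.2) = 0 ∧ primEval l (l / 2) k.2.1 = 0 ∧
    primEval l (l / 2) (primLp l k.2.1) = 0 ∧ primEval l (l / 2) k.2.2 = 0}
  zero_mem' := by
    simp only [Set.mem_ofPred_eq, Prod.fst_zero, Prod.snd_zero, map_zero, and_self]
  add_mem' := by
    rintro a b ⟨a1, a2, a3, a4, a5, a6⟩ ⟨b1, b2, b3, b4, b5, b6⟩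
    simp only [Set.mem_ofPred_eq, Prod.fst_add, Prod.snd_add, map_add, a1, a2, a3, a4, a5, a6,
      b1, b2, b3, b4, b5, b6, add_zero, and_self]
  smul_mem' := by
    rintro c a ⟨a1, a2, a3, a4, a5, a6⟩
    simp only [Set.mem_ofPred_eq, Prod.smul_fst, Prod.smul_snd, map_smul, a1, a2, a3, a4, a5, a6,
      smul_zero, and_self]

/-- An intersection of six kernels of continuous functionals; closedness supplies the completeness
needed for the projection. -/
theorem isClosed_incr (l : ℝ) : IsClosed (incr l : Set (Quad l)) := by
  have h : ∀ f : Quad l → ℝ, Continuous f → IsClosed {k | f k = 0} := fun f hf =>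
    isClosed_eq hf continuous_const
  exact (h _ (by fun_prop)).inter <| (h _ (by fun_prop)).inter <| (h _ (by fun_prop)).inter <|
    (h _ (by fun_prop)).inter <| (h _ (by fun_prop)).inter (h _ (by fun_prop))

variable {bu₁ : W12 l} {bu₂ bv : W22 l}

/-- `z` arises from `u` by the increment with highest derivatives `k`. -/
structure IsIncr (u z : S1D l bu₁ bu₂ bv) (k : Quad l) : Prop where
  strain : z.y₁.d1 = u.y₁.d1 + strainLp l k.1
  w_d1 : z.w.d1 = u.w.d1 + primLp l k.2.1
  w_d2 : z.w.d2 = u.w.d2 + k.2.1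
  θ_d1 : z.θ.d1 = u.θ.d1 + k.2.2

/-- Integrate k from the left end and add the result to u. Primitives vanish at the left end, and
membership in `incr` makes them vanish at the right end, so the boundary values persist. -/
theorem S1D.exists_isIncr_of_mem (hl : 0 < l) (u : S1D l bu₁ bu₂ bv) {k : Quad l}
    (hk : k ∈ incr l) : ∃ z, IsIncr u z k := by
  obtain ⟨⟨a, b⟩, c, d⟩ := k
  obtain ⟨ha, hb, hb', hc, hc', hd⟩ := hk
  simp only at ha hb hb' hc hc' hd
  obtain ⟨ξ₁, ξ₂, h1, h2, hy₁, hy₂⟩ := isBN_iff.1 u.bn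
  have hP := hasWeakDeriv_primLp hl
  have hb2 := hP (primLp l b)
  let ξ₁' : W12 l := ⟨ξ₁.fn + primLp l a, ξ₁.d1 + a, ξ₁.weak_d1.add_Lp (hP a)⟩
  let ξ₂' : W22 l := ⟨ξ₂.fn + primLp l (primLp l b), ξ₂.d1 + primLp l b, ξ₂.d2 + b,
    ξ₂.weak_d1.add_Lp (hP _), ξ₂.weak_d2.add_Lp (hP _)⟩
  let w' : W22 l := ⟨u.w.fn + primLp l (primLp l c), u.w.d1 + primLp l c, u.w.d2 + c,
    u.w.weak_d1.add_Lp (hP _), u.w.weak_d2.add_Lp (hP _)⟩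
  let θ' : W12 l := ⟨u.θ.fn + primLp l d, u.θ.d1 + d, u.θ.weak_d1.add_Lp (hP d)⟩
  let y₁' : W12S l := ⟨u.y₁.fn + strainLp l (primLp l a, primLp l b), u.y₁.d1 + strainLp l (a, b),
    u.y₁.d2 + -fstLp l (primLp l b), u.y₁.weak_d1.add_Lp ((hP a).strainLp (hP b)),
    u.y₁.weak_d2.add_Lp (hasWeakPartial_snd_strainLp _ _)⟩
  let y₂' : W12S l := ⟨u.y₂.fn + fstLp l (primLp l (primLp l b)), u.y₂.d1 + fstLp l (primLp l b),
    u.y₂.d2 + 0, u.y₂.weak_d1.add_Lp (hP _).fstLp,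
    u.y₂.weak_d2.add_Lp (hasWeakPartial_snd_fstLp _)⟩
  have htr : ∀ {f g f' g' p : Lp ℝ 2 (μI l)}, HasWeakDeriv l f g → HasWeakDeriv l f' g' →
      SameTrace l f f' → primEval l (l / 2) p = 0 →
      SameTrace l (f + primLp l p : Lp ℝ 2 (μI l)) f' := by
    intro f g f' g' p h h' hs hp
    refine (sameTrace_trans_iff hl h (h.add_Lp (hP p)) h' hs).2 ?_
    simp only [add_sub_cancel_left, true_and, hp]
  refine ⟨⟨y₁', y₂', w', θ', isBN_iff.2 ⟨ξ₁', ξ₂', ?_, ⟨?_, ?_⟩, ?_, ?_⟩, ⟨?_, ?_⟩, ?_⟩,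
    ⟨rfl, rfl, rfl, rfl⟩⟩
  · exact htr ξ₁.weak_d1 bu₁.weak_d1 h1 ha
  · exact htr ξ₂.weak_d1 bu₂.weak_d1 h2.1 hb'
  · exact htr ξ₂.weak_d2 bu₂.weak_d2 h2.2 hb
  · change u.y₁.fn + strainLp l (primLp l a, primLp l b) =
      strainLp l (ξ₁.fn + primLp l a, ξ₂.d1 + primLp l b)
    rw [hy₁, ← map_add]; rfl
  · change u.y₂.fn + fstLp l (primLp l (primLp l b)) = fstLp l (ξ₂.fn + primLp l (primLp l b))
    rw [hy₂, ← map_add]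
  · exact htr u.w.weak_d1 bv.weak_d1 u.w_bdry.1 hc'
  · exact htr u.w.weak_d2 bv.weak_d2 u.w_bdry.2 hc
  · exact htr u.θ.weak_d1 (0 : W12 l).weak_d1 u.θ_bdry hd

/-- Equal boundary values force every difference to be the primitive of its derivative, so the
differences of highest derivatives determine everything below them. The last clause serves the
uniqueness of the minimizer. -/
theorem S1D.exists_isIncr (hl : 0 < l) (u z : S1D l bu₁ bu₂ bv) :
    ∃ k ∈ incr l, IsIncr u z k ∧ (k = 0 → z = u) := by
  obtain ⟨ξ₁, ξ₂, h1, h2, hy₁, hy₂⟩ := isBN_iff.1 u.bn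
  obtain ⟨η₁, η₂, g1, g2, hz₁, hz₂⟩ := isBN_iff.1 z.bn
  obtain ⟨a1, a2⟩ := (sameTrace_trans_iff hl ξ₁.weak_d1 η₁.weak_d1 bu₁.weak_d1 h1).1 g1
  obtain ⟨b1, b2⟩ := (sameTrace_trans_iff hl ξ₂.weak_d1 η₂.weak_d1 bu₂.weak_d1 h2.1).1 g2.1
  obtain ⟨b3, b4⟩ := (sameTrace_trans_iff hl ξ₂.weak_d2 η₂.weak_d2 bu₂.weak_d2 h2.2).1 g2.2
  obtain ⟨c1, c2⟩ :=
    (sameTrace_trans_iff hl u.w.weak_d1 z.w.weak_d1 bv.weak_d1 u.w_bdry.1).1 z.w_bdry.1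
  obtain ⟨c3, c4⟩ :=
    (sameTrace_trans_iff hl u.w.weak_d2 z.w.weak_d2 bv.weak_d2 u.w_bdry.2).1 z.w_bdry.2
  obtain ⟨d1, d2⟩ :=
    (sameTrace_trans_iff hl u.θ.weak_d1 z.θ.weak_d1 (0 : W12 l).weak_d1 u.θ_bdry).1 z.θ_bdry
  refine ⟨((η₁.d1 - ξ₁.d1, η₂.d2 - ξ₂.d2), z.w.d2 - u.w.d2, z.θ.d1 - u.θ.d1),
    ⟨a2, b4, b3 ▸ b2, c4, c3 ▸ c2, d2⟩, ⟨?_, ?_, ?_, ?_⟩, fun h => ?_⟩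
  -- The stored derivative of y₁ is the strain ξ₁' - x₂ ξ₂'' by uniqueness of weak derivatives.
  · have e1 := u.y₁.weak_d1
    have e2 := z.y₁.weak_d1
    rw [hy₁] at e1
    rw [hz₁] at e2
    rw [e1.unique (ξ₁.weak_d1.strainLp ξ₂.weak_d2), e2.unique (η₁.weak_d1.strainLp η₂.weak_d2),
      ← map_add]
    simp only [Prod.mk_add_mk, add_sub_cancel]
  · rw [← c3]; abel
  · exact (add_sub_cancel _ _).symm
  · exact (add_sub_cancel _ _).symm
  · simp only [Prod.mk_eq_zero] at h
    obtain ⟨⟨h1, h2⟩, h3, h4⟩ := h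
    rw [h1, map_zero, sub_eq_zero] at a1
    rw [h2, map_zero, sub_eq_zero] at b3
    rw [b3, sub_self, map_zero, sub_eq_zero] at b1
    rw [h3, map_zero, sub_eq_zero] at c3
    rw [c3, sub_self, map_zero, sub_eq_zero] at c1
    rw [h4, map_zero, sub_eq_zero] at d1
    rw [sub_eq_zero] at h3 h4
    have ey₁ : z.y₁ = u.y₁ := W12S.ext_fn (by rw [hy₁, hz₁, a1, b3])
    have ey₂ : z.y₂ = u.y₂ := W12S.ext_fn (by rw [hy₂, hz₂, b1])
    have ew : z.w = u.w := by
      have : ∀ v w : W22 l, v.fn = w.fn → v.d1 = w.d1 → v.d2 = w.d2 → v = w := by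
        rintro ⟨_, _, _, _, _⟩ ⟨_, _, _, _, _⟩ rfl rfl rfl; rfl
      exact this _ _ c1 c3 h3
    have eθ : z.θ = u.θ := by
      have : ∀ v w : W12 l, v.fn = w.fn → v.d1 = w.d1 → v = w := by
        rintro ⟨_, _, _⟩ ⟨_, _, _⟩ rfl rfl; rfl
      exact this _ _ d1 h4
    obtain ⟨_, _, _, _, _, _, _⟩ := z
    obtain ⟨_, _, _, _, _, _, _⟩ := u
    simp only at ey₁ ey₂ ew eθ
    subst ey₁ ey₂ ew eθ
    rfl

/-- A base point: test functions become increments of it, which replaces a vector space structure on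
`TestSpace`. -/
theorem exists_zero_testSpace (hl : 0 < l) :
    ∃ o : TestSpace l, o.y₁.d1 = 0 ∧ o.w.d1 = 0 ∧ o.w.d2 = 0 ∧ o.θ.d1 = 0 := by
  have hz := hasWeakDeriv_zero l
  have ht : SameTrace l (0 : Lp ℝ 2 (μI l)) (0 : Lp ℝ 2 (μI l)) :=
    (sameTrace_iff hl hz hz).2 ⟨by rw [sub_self, map_zero], by rw [sub_self, map_zero]⟩
  have hf : HasWeakPartial l (1, 0) (0 : Lp ℝ 2 (μS l)) (0 : Lp ℝ 2 (μS l)) := by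
    simpa only [map_zero] using hz.fstLp
  have hs : HasWeakPartial l (0, 1) (0 : Lp ℝ 2 (μS l)) (0 : Lp ℝ 2 (μS l)) := by
    simpa only [map_zero] using hasWeakPartial_snd_fstLp (0 : Lp ℝ 2 (μI l))
  let y : W12S l := ⟨0, 0, 0, hf, hs⟩
  refine ⟨⟨y, y, 0, 0, isBN_iff.2 ⟨0, 0, ht, ⟨ht, ht⟩, ?_, ?_⟩, ⟨ht, ht⟩, ht⟩, rfl, rfl, rfl, rfl⟩
  · exact (map_zero (strainLp l)).symm
  · exact (map_zero (fstLp l)).symm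

end Increments

/-! ### Linearization of `G` and its quadratic remainder -/

section Linearization

variable {l : ℝ} {bu₁ : W12 l} {bu₂ bv : W22 l}

theorem W22.memLp_d1_fst (hl : 0 < l) (w : W22 l) : MemLp (fun x => w.d1 x.1) ∞ (μS l) :=
  (w.weak_d2.memLp_top hl).comp_measurePreserving (measurePreserving_fst_μS l)

/-- `G` as an element of `L²(S;ℝ³)`. -/
def gLp (hl : 0 < l) (u : S1D l bu₁ bu₂ bv) : Lp E3 2 (μS l) :=
  vecLp (μS l) (u.y₁.d1 + (1 / 2 : ℝ) • mulBdd _ (u.w.memLp_d1_fst hl) (fstLp l u.w.d1),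
    fstLp l u.w.d2, fstLp l u.θ.d1)

theorem coeFn_gLp_fst (hl : 0 < l) (u : S1D l bu₁ bu₂ bv) :
    (u.y₁.d1 + (1 / 2 : ℝ) • mulBdd _ (u.w.memLp_d1_fst hl) (fstLp l u.w.d1) : Lp ℝ 2 (μS l))
      =ᵐ[μS l] fun x => u.y₁.d1 x + u.w.d1 x.1 ^ 2 / 2 := by
  filter_upwards [Lp.coeFn_add u.y₁.d1
      ((1 / 2 : ℝ) • mulBdd _ (u.w.memLp_d1_fst hl) (fstLp l u.w.d1)),
    Lp.coeFn_smul (1 / 2 : ℝ) (mulBdd _ (u.w.memLp_d1_fst hl) (fstLp l u.w.d1)),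
    coeFn_mulBdd (u.w.memLp_d1_fst hl) (fstLp l u.w.d1), coeFn_fstLp u.w.d1] with x h1 h2 h3 h4
  rw [h1, Pi.add_apply, h2, Pi.smul_apply, h3, h4, smul_eq_mul]
  ring

theorem coeFn_gLp (hl : 0 < l) (u : S1D l bu₁ bu₂ bv) : gLp hl u =ᵐ[μS l] G u := by
  filter_upwards [coeFn_vecLp (u.y₁.d1 + (1 / 2 : ℝ) • mulBdd _ (u.w.memLp_d1_fst hl)
      (fstLp l u.w.d1), fstLp l u.w.d2, fstLp l u.θ.d1), coeFn_gLp_fst hl u,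
    coeFn_fstLp u.w.d2, coeFn_fstLp u.θ.d1] with x h1 h2 h3 h4
  rw [gLp, h1, G]
  simp only [h2, h3, h4]

/-- `H` as an element of `L²(S;ℝ³)`. -/
def hLp (hl : 0 < l) (p : S1D l bu₁ bu₂ bv) (w : W22 l) : Lp E3 2 (μS l) :=
  vecLp (μS l) (p.y₁.d1 + mulBdd _ (w.memLp_d1_fst hl) (fstLp l p.w.d1),
    fstLp l p.w.d2, fstLp l p.θ.d1)

theorem coeFn_hLp (hl : 0 < l) (p : S1D l bu₁ bu₂ bv) (w : W22 l) :
    hLp hl p w =ᵐ[μS l] H p w := by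
  filter_upwards [coeFn_vecLp (p.y₁.d1 + mulBdd _ (w.memLp_d1_fst hl) (fstLp l p.w.d1),
      fstLp l p.w.d2, fstLp l p.θ.d1),
    Lp.coeFn_add p.y₁.d1 (mulBdd _ (w.memLp_d1_fst hl) (fstLp l p.w.d1)),
    coeFn_mulBdd (w.memLp_d1_fst hl) (fstLp l p.w.d1), coeFn_fstLp p.w.d1,
    coeFn_fstLp p.w.d2, coeFn_fstLp p.θ.d1] with x h1 h2 h3 h4 h5 h6
  rw [hLp, h1, H]
  simp only [h2, Pi.add_apply, h3, h4, h5, h6, mul_comm]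

/-- The linearization of `G` at a configuration with deflection `w`, in terms of the highest
derivatives of an increment. -/
def linLp (hl : 0 < l) (w : W22 l) : Quad l →L[ℝ] Lp E3 2 (μS l) :=
  (vecLp (μS l)).comp
    (((strainLp l).comp (ContinuousLinearMap.fst ℝ _ _) +
      ((mulBdd _ (w.memLp_d1_fst hl)).comp ((fstLp l).toContinuousLinearMap.comp (primLp l))).comp
        ((ContinuousLinearMap.fst ℝ _ _).comp (ContinuousLinearMap.snd ℝ _ _))).prod
    (((fstLp l).toContinuousLinearMap.comp
      ((ContinuousLinearMap.fst ℝ _ _).comp (ContinuousLinearMap.snd ℝ _ _))).prod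
    ((fstLp l).toContinuousLinearMap.comp
      ((ContinuousLinearMap.snd ℝ _ _).comp (ContinuousLinearMap.snd ℝ _ _)))))

theorem linLp_apply (hl : 0 < l) (w : W22 l) (k : Quad l) :
    linLp hl w k = vecLp (μS l)
      (strainLp l k.1 + mulBdd _ (w.memLp_d1_fst hl) (fstLp l (primLp l k.2.1)),
        fstLp l k.2.1, fstLp l k.2.2) := rfl

theorem coeFn_linLp (hl : 0 < l) (w : W22 l) (k : Quad l) :
    linLp hl w k =ᵐ[μS l] fun x =>
      !₂[strainLp l k.1 x + w.d1 x.1 * prim l k.2.1 x.1, k.2.1 x.1, k.2.2 x.1] := by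
  rw [linLp_apply]
  filter_upwards [coeFn_vecLp (strainLp l k.1 +
      mulBdd _ (w.memLp_d1_fst hl) (fstLp l (primLp l k.2.1)), fstLp l k.2.1, fstLp l k.2.2),
    Lp.coeFn_add (strainLp l k.1) (mulBdd _ (w.memLp_d1_fst hl) (fstLp l (primLp l k.2.1))),
    coeFn_mulBdd (w.memLp_d1_fst hl) (fstLp l (primLp l k.2.1)), coeFn_fstLp (primLp l k.2.1),
    coeFn_fstLp k.2.1, coeFn_fstLp k.2.2, ae_fst (coeFn_primLp k.2.1)]
    with x h1 h2 h3 h4 h5 h6 h7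
  rw [h1]
  simp only [h2, Pi.add_apply, h3, h4, h5, h6, h7]

/-- The last two components give w'' and θ' directly. Subtracting the coupling term, a bounded
operator P of w'', from the first component leaves the strain, which controls ξ₁' and ξ₂''. -/
theorem exists_norm_le_linLp (hl : 0 < l) (w : W22 l) :
    ∃ K : ℝ, 0 ≤ K ∧ ∀ k, ‖k‖ ≤ K * ‖linLp hl w k‖ := by
  set P := (mulBdd _ (w.memLp_d1_fst hl)).comp ((fstLp l).toContinuousLinearMap.comp (primLp l))
    with hP
  refine ⟨4 * (1 + ‖P‖), by positivity, ?_⟩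
  rintro ⟨⟨a, b⟩, c, d⟩
  obtain ⟨h1, h2, h3⟩ := norm_le_norm_vecLp (strainLp l (a, b) + P c, fstLp l c, fstLp l d)
  change _ ≤ 4 * (1 + ‖P‖) * ‖vecLp (μS l) (strainLp l (a, b) + P c, fstLp l c, fstLp l d)‖
  set N := ‖vecLp (μS l) (strainLp l (a, b) + P c, fstLp l c, fstLp l d)‖
  simp only [LinearIsometry.norm_map] at h1 h2 h3
  have h4 : ‖strainLp l (a, b)‖ ≤ (1 + ‖P‖) * N := by
    calc ‖strainLp l (a, b)‖ = ‖(strainLp l (a, b) + P c) - P c‖ := by rw [add_sub_cancel_right]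
      _ ≤ ‖strainLp l (a, b) + P c‖ + ‖P c‖ := norm_sub_le _ _
      _ ≤ N + ‖P‖ * N := add_le_add h1 ((P.le_opNorm c).trans (by gcongr))
      _ = _ := by ring
  obtain ⟨h5, h6⟩ := norm_le_norm_strainLp a b
  have hN : 0 ≤ N := norm_nonneg _
  have hPN : 0 ≤ ‖P‖ * N := by positivity
  refine max_le (max_le ?_ ?_) (max_le ?_ ?_) <;> dsimp only <;> linarith

/-- The expansion of |w'|²/2 leaves exactly half the square of the increment of w', a primitive
bounded uniformly by ‖k.2.1‖. -/
theorem exists_norm_gLp_sub_le (hl : 0 < l) :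
    ∃ C : ℝ, 0 ≤ C ∧ ∀ (u z : S1D l bu₁ bu₂ bv) (k : Quad l), IsIncr u z k →
      ‖gLp hl z - gLp hl u - linLp hl u.w k‖ ≤ C * ‖k.2.1‖ ^ 2 := by
  obtain ⟨C, hC, hprim⟩ := exists_abs_prim_le l
  -- The measure factor passes from a uniform bound to the L² norm.
  refine ⟨(μS l).real Set.univ ^ (2 : ℝ≥0∞).toReal⁻¹ * (C ^ 2 / 2), by positivity,
    fun u z k hk => ?_⟩
  rw [mul_assoc]
  refine Lp.norm_le_of_ae_bound (by positivity) ?_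
  have hw : z.w.d1 =ᵐ[μI l] fun x => u.w.d1 x + prim l k.2.1 x := by
    rw [hk.w_d1]
    filter_upwards [Lp.coeFn_add u.w.d1 (primLp l k.2.1), coeFn_primLp k.2.1] with x h1 h2
    rw [h1, Pi.add_apply, h2]
  have hd2 : z.w.d2 =ᵐ[μI l] fun x => u.w.d2 x + k.2.1 x := by
    rw [hk.w_d2]; exact Lp.coeFn_add _ _
  have hθ : z.θ.d1 =ᵐ[μI l] fun x => u.θ.d1 x + k.2.2 x := by
    rw [hk.θ_d1]; exact Lp.coeFn_add _ _
  have hy : z.y₁.d1 =ᵐ[μS l] fun x => u.y₁.d1 x + strainLp l k.1 x := by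
    rw [hk.strain]; exact Lp.coeFn_add _ _
  filter_upwards [Lp.coeFn_sub (gLp hl z - gLp hl u) (linLp hl u.w k),
    Lp.coeFn_sub (gLp hl z) (gLp hl u), coeFn_gLp hl u, coeFn_gLp hl z, coeFn_linLp hl u.w k,
    ae_fst hw, ae_fst hd2, ae_fst hθ, hy] with x h1 h2 h3 h4 h5 h6 h7 h8 h9
  have e : (gLp hl z - gLp hl u - linLp hl u.w k : Lp E3 2 (μS l)) x =
      EuclideanSpace.single (0 : Fin 3) (prim l k.2.1 x.1 ^ 2 / 2) := by
    rw [h1, Pi.sub_apply, h2, Pi.sub_apply, h3, h4, h5, G, G, h6, h7, h8, h9]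
    ext i
    fin_cases i <;> simp
    ring
  rw [e, PiLp.norm_single, Real.norm_of_nonneg (by positivity)]
  have := pow_le_pow_left₀ (abs_nonneg _) (hprim k.2.1 x.1) 2
  rw [sq_abs, mul_pow] at this
  linarith

/-- The second component of `G` is w'', which is linear. This converts the quadratic remainder into
one measured by the increment of `G`, hence by the distance. -/
theorem IsIncr.norm_le_norm_gLp_sub (hl : 0 < l) {u z : S1D l bu₁ bu₂ bv} {k : Quad l}
    (hk : IsIncr u z k) : ‖k.2.1‖ ≤ ‖gLp hl z - gLp hl u‖ := by
  rw [gLp, gLp, ← map_sub]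
  have h := (norm_le_norm_vecLp ((z.y₁.d1 + (1 / 2 : ℝ) • mulBdd _ (z.w.memLp_d1_fst hl)
    (fstLp l z.w.d1), fstLp l z.w.d2, fstLp l z.θ.d1) -
    (u.y₁.d1 + (1 / 2 : ℝ) • mulBdd _ (u.w.memLp_d1_fst hl) (fstLp l u.w.d1),
      fstLp l u.w.d2, fstLp l u.θ.d1))).2.1
  rw [Prod.snd_sub, Prod.fst_sub] at h
  simp only [hk.w_d2, map_add, add_sub_cancel_left, LinearIsometry.norm_map] at h
  rwa [hk.w_d2, map_add]

theorem IsIncr.hLp_eq (hl : 0 < l) {o p : TestSpace l} (ho : o.y₁.d1 = 0 ∧ o.w.d1 = 0 ∧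
    o.w.d2 = 0 ∧ o.θ.d1 = 0) {k : Quad l} (hk : IsIncr o p k) (w : W22 l) :
    hLp hl p w = linLp hl w k := by
  obtain ⟨h1, h2, h3, h4⟩ := ho
  rw [hLp, linLp_apply, hk.strain, hk.w_d1, hk.w_d2, hk.θ_d1, h1, h2, h3, h4]
  simp only [zero_add]

end Linearization

/-! ### Energy, distance and auxiliary functional as Hilbert space expressions -/

section Energy

variable {l : ℝ} {bu₁ : W12 l} {bu₂ bv : W22 l}
  {Q QW QR : QuadraticForm ℝ (Matrix (Fin 2) (Fin 2) ℝ)}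

theorem integral_fst {f : ℝ → ℝ} (hf : AEStronglyMeasurable f (μI l)) :
    ∫ x in S l, f x.1 = ∫ x in I l, f x := by
  have hmp := measurePreserving_fst_μS l
  rw [← hmp.map_eq] at hf
  have h := integral_map hmp.aemeasurable hf
  rw [hmp.map_eq] at h
  exact h.symm

/-- The cross-section has length one, so integrals over I equal integrals over S and the sum is the
integral of `Qbar`. -/
theorem IsAdmissible.inner_mulLp_vecLp (hQ : IsAdmissible Q) (a : Lp ℝ 2 (μS l))
    (b c : Lp ℝ 2 (μI l)) :
    inner ℝ (mulLp (μS l) (Cbar Q) (vecLp (μS l) (a, fstLp l b, fstLp l c)))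
      (vecLp (μS l) (a, fstLp l b, fstLp l c)) =
      (∫ x in S l, Q0 Q (a x)) + 1 / 12 * ∫ x in I l, Q1 Q (b x) (c x) := by
  obtain ⟨p, q, r, s, -, -, -, h1, h0⟩ := hQ.exists_Q1_Q0_eq
  have i0 : Integrable (fun x => Q0 Q (a x)) (μS l) := by
    simp only [h0]
    exact (Lp.memLp a).integrable_sq.const_mul s
  have i1 : Integrable (fun x => Q1 Q (b x) (c x)) (μI l) := by
    simp only [h1]
    exact (((Lp.memLp b).integrable_sq.const_mul p).add
      (((Lp.memLp b).integrable_mul (Lp.memLp c)).const_mul (2 * q))).add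
      ((Lp.memLp c).integrable_sq.const_mul r)
  have hmp := measurePreserving_fst_μS l
  have e1 : ∫ x in I l, Q1 Q (b x) (c x) = ∫ x in S l, Q1 Q (b x.1) (c x.1) :=
    (integral_fst i1.aestronglyMeasurable).symm
  have i1S : Integrable (fun x => Q1 Q (b x.1) (c x.1)) (μS l) :=
    hmp.integrable_comp_of_integrable i1
  rw [inner_mulLp, e1, ← integral_const_mul, ← integral_add i0 (i1S.const_mul _)]
  refine integral_congr_ae ?_
  filter_upwards [coeFn_vecLp (a, fstLp l b, fstLp l c), coeFn_fstLp b, coeFn_fstLp c]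
    with x h1 h2 h3
  simp only [hQ.Cbar_spec.2, h1, h2, h3]
  simp [Qbar]

theorem IsAdmissible.energy_eq (hW : IsAdmissible QW) (hl : 0 < l) (u : S1D l bu₁ bu₂ bv) :
    energy QW u = 1 / 2 * inner ℝ (mulLp (μS l) (Cbar QW) (gLp hl u)) (gLp hl u) := by
  rw [gLp, hW.inner_mulLp_vecLp, energy]
  have : ∫ x in S l, Q0 QW (u.y₁.d1 x + u.w.d1 x.1 ^ 2 / 2) = ∫ x in S l, Q0 QW ((u.y₁.d1 +
      (1 / 2 : ℝ) • mulBdd _ (u.w.memLp_d1_fst hl) (fstLp l u.w.d1) : Lp ℝ 2 (μS l)) x) := by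
    refine integral_congr_ae ?_
    filter_upwards [coeFn_gLp_fst hl u] with x hx
    rw [hx]
  rw [this]
  ring

theorem IsAdmissible.norm_sqrt_sq (hR : IsAdmissible QR) (f : Lp E3 2 (μS l)) :
    ‖mulLp (μS l) (sqrtCbar QR) f‖ ^ 2 = inner ℝ (mulLp (μS l) (Cbar QR) f) f := by
  rw [← real_inner_self_eq_norm_sq, real_inner_comm, ← hR.sqrtCbar_mul_self, ← mulLp_mul,
    inner_mulLp_left (sqrtCbar_posSemidef QR).isHermitian,
    inner_mulLp_left (sqrtCbar_posSemidef QR).isHermitian,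
    inner_mulLp_left (sqrtCbar_posSemidef QR).isHermitian]

theorem IsAdmissible.dist0_eq (hR : IsAdmissible QR) (hl : 0 < l) (u z : S1D l bu₁ bu₂ bv) :
    dist0 QR u z = ‖mulLp (μS l) (sqrtCbar QR) (gLp hl z - gLp hl u)‖ := by
  rw [← Real.sqrt_sq (norm_nonneg (mulLp (μS l) (sqrtCbar QR) (gLp hl z - gLp hl u))),
    map_sub, norm_sub_rev, ← map_sub, hR.norm_sqrt_sq, gLp, gLp, ← map_sub, Prod.mk_sub_mk,
    Prod.mk_sub_mk, ← map_sub, ← map_sub, hR.inner_mulLp_vecLp, dist0]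
  congr 2
  · refine integral_congr_ae ?_
    filter_upwards [coeFn_gLp_fst hl u, coeFn_gLp_fst hl z, Lp.coeFn_sub
      (u.y₁.d1 + (1 / 2 : ℝ) • mulBdd _ (u.w.memLp_d1_fst hl) (fstLp l u.w.d1))
      (z.y₁.d1 + (1 / 2 : ℝ) • mulBdd _ (z.w.memLp_d1_fst hl) (fstLp l z.w.d1))] with x h1 h2 h3
    rw [h3, Pi.sub_apply, h1, h2]
    congr 1; ring
  · congr 1
    refine integral_congr_ae ?_
    filter_upwards [Lp.coeFn_sub u.w.d2 z.w.d2, Lp.coeFn_sub u.θ.d1 z.θ.d1] with x h1 h2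
    rw [h1, h2, Pi.sub_apply, Pi.sub_apply]

theorem auxF_eq (hl : 0 < l) (u : S1D l bu₁ bu₂ bv) (p : TestSpace l) :
    auxF QW QR u p = 1 / 2 * ‖mulLp (μS l) (sqrtCbar QR) (hLp hl p u.w)‖ ^ 2 -
      inner ℝ (mulLp (μS l) (Cbar QW) (gLp hl u)) (hLp hl p u.w) := by
  have e : ‖mulLp (μS l) (sqrtCbar QR) (hLp hl p u.w)‖ ^ 2 =
      ∫ x in S l, ‖(sqrtCbar QR).toEuclideanLin (H p u.w x)‖ ^ 2 := by
    rw [← real_inner_self_eq_norm_sq, L2.inner_def]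
    refine integral_congr_ae ?_
    filter_upwards [coeFn_mulLp (sqrtCbar QR) (hLp hl p u.w), coeFn_hLp hl p u.w] with x h1 h2
    rw [h1, h2, real_inner_self_eq_norm_sq]
  have e' : inner ℝ (mulLp (μS l) (Cbar QW) (gLp hl u)) (hLp hl p u.w) =
      ∫ x in S l, inner ℝ ((Cbar QW).toEuclideanLin (G u x)) (H p u.w x) := by
    rw [inner_mulLp]
    refine integral_congr_ae ?_
    filter_upwards [coeFn_gLp hl u, coeFn_hLp hl p u.w] with x h1 h2
    rw [h1, h2]
  rw [auxF, e, e']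

end Energy

/-! ### Projection, slope and completed square -/

section Main

variable {l : ℝ} {bu₁ : W12 l} {bu₂ bv : W22 l}
  {QW QR : QuadraticForm ℝ (Matrix (Fin 2) (Fin 2) ℝ)}

theorem IsAdmissible.mulLp_inv_sqrt (hR : IsAdmissible QR) (f : Lp E3 2 (μS l)) :
    mulLp (μS l) (sqrtCbar QR)⁻¹ (mulLp (μS l) (sqrtCbar QR) f) = f := by
  rw [mulLp_mul, Matrix.nonsing_inv_mul _ hR.isUnit_det_sqrtCbar, mulLp_one]

theorem IsAdmissible.mulLp_sqrt_inv (hR : IsAdmissible QR) (f : Lp E3 2 (μS l)) :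
    mulLp (μS l) (sqrtCbar QR) (mulLp (μS l) (sqrtCbar QR)⁻¹ f) = f := by
  rw [mulLp_mul, Matrix.mul_nonsing_inv _ hR.isUnit_det_sqrtCbar, mulLp_one]

theorem IsAdmissible.exists_norm_le_mulLp_sqrt (hR : IsAdmissible QR) (l : ℝ) :
    ∃ c : ℝ, 0 < c ∧ ∀ f : Lp E3 2 (μS l), c * ‖f‖ ≤ ‖mulLp (μS l) (sqrtCbar QR) f‖ := by
  set B := mulLp (μS l) (sqrtCbar QR)⁻¹
  refine ⟨(‖B‖ + 1)⁻¹, by positivity, fun f => ?_⟩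
  rw [inv_mul_le_iff₀ (by positivity)]
  calc ‖f‖ = ‖B (mulLp (μS l) (sqrtCbar QR) f)‖ := by rw [hR.mulLp_inv_sqrt]
    _ ≤ ‖B‖ * ‖mulLp (μS l) (sqrtCbar QR) f‖ := B.le_opNorm _
    _ ≤ _ := by gcongr; linarith

/-- The Galerkin orthogonality: `C̄_W G(u)` is represented on the tangent directions by a
tangent direction in the inner product of `C̄_R`. -/
theorem IsAdmissible.exists_mem_incr (hR : IsAdmissible QR) (hl : 0 < l) (w : W22 l)
    (g : Lp E3 2 (μS l)) :
    ∃ k₀ ∈ incr l, ∀ k ∈ incr l, inner ℝ g (linLp hl w k) =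
      inner ℝ (mulLp (μS l) (sqrtCbar QR) (linLp hl w k₀))
        (mulLp (μS l) (sqrtCbar QR) (linLp hl w k)) := by
  have hcl : CompleteSpace (incr l) := (isClosed_incr l).completeSpace_coe
  set R := mulLp (μS l) (sqrtCbar QR)
  let A : incr l →L[ℝ] Lp E3 2 (μS l) := R.comp ((linLp hl w).comp (incr l).subtypeL)
  obtain ⟨c, hc, hRc⟩ := hR.exists_norm_le_mulLp_sqrt l
  obtain ⟨K, hK, hKk⟩ := exists_norm_le_linLp hl w
  -- Coercivity bounds A from below, so its range is complete and admits orthogonal projection.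
  have hanti : AntilipschitzWith (K / c).toNNReal A := by
    refine A.antilipschitz_of_bound fun k => ?_
    rw [Real.coe_toNNReal _ (by positivity)]
    calc ‖k‖ ≤ K * ‖linLp hl w k‖ := hKk k
      _ ≤ K * (‖A k‖ / c) := by
        gcongr
        rw [le_div_iff₀ hc, mul_comm]
        exact hRc _
      _ = _ := by ring
  have hcomp : IsComplete (A.range : Set (Lp E3 2 (μS l))) :=
    hanti.isComplete_range A.uniformContinuous
  have hcs : CompleteSpace A.range := hcomp.completeSpace_coe
  -- Pairing (√C̄_R)⁻¹g with √C̄_R h gives ⟨g, h⟩ by symmetry of the root, so this projection is the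
  -- Riesz representative.
  obtain ⟨q, ⟨k₀, rfl⟩, hq⟩ := Submodule.HasOrthogonalProjection.exists_orthogonal
    (K := A.range) (mulLp (μS l) (sqrtCbar QR)⁻¹ g)
  refine ⟨k₀, k₀.2, fun k hk => ?_⟩
  have h := (Submodule.mem_orthogonal' _ _).1 hq (A ⟨k, hk⟩) ⟨_, rfl⟩
  rw [inner_sub_left, sub_eq_zero] at h
  change inner ℝ _ (R (linLp hl w k)) = inner ℝ (R (linLp hl w k₀)) (R (linLp hl w k)) at h
  rw [← h, ← inner_mulLp_left (sqrtCbar_posSemidef QR).isHermitian, hR.mulLp_sqrt_inv]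

theorem IsAdmissible.localSlope_eq (hW : IsAdmissible QW) (hR : IsAdmissible QR) (hl : 0 < l)
    (u : S1D l bu₁ bu₂ bv) {k₀ : Quad l} (hk₀ : k₀ ∈ incr l)
    (h : ∀ k ∈ incr l, inner ℝ (mulLp (μS l) (Cbar QW) (gLp hl u)) (linLp hl u.w k) =
      inner ℝ (mulLp (μS l) (sqrtCbar QR) (linLp hl u.w k₀))
        (mulLp (μS l) (sqrtCbar QR) (linLp hl u.w k))) :
    localSlope (energy QW) (dist0 QR) u =
      ENNReal.ofReal ‖mulLp (μS l) (sqrtCbar QR) (linLp hl u.w k₀)‖ := by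
  obtain ⟨c, hc, hRc⟩ := hR.exists_norm_le_mulLp_sqrt l
  obtain ⟨C, hC, hg⟩ := exists_norm_gLp_sub_le (bu₁ := bu₁) (bu₂ := bu₂) (bv := bv) hl
  -- The steepest descent curve: the increment -t k₀, realized by an admissible configuration.
  choose z hz using fun t : ℝ => u.exists_isIncr_of_mem hl ((incr l).smul_mem (-t) hk₀)
  have hCW := hW.Cbar_spec.1
  refine localSlope_quadratic (g := gLp hl) (W := mulLp (μS l) (Cbar QW))
    (M := (incr l).map (linLp hl u.w : Quad l →ₗ[ℝ] Lp E3 2 (μS l)))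
    -- The first summand covers arbitrary increments, the second the remainder along the curve.
    (z := z) (C := C + C * ‖k₀.2.1‖ ^ 2)
    (hW.energy_eq hl) (fun x y => ?_) (fun x => ?_) (hR.dist0_eq hl u) hc hRc
    (Submodule.mem_map_of_mem hk₀) ?_ (by positivity) (fun v => ?_) (fun t _ => ?_)
  · rw [inner_mulLp_left hCW.isHermitian, real_inner_comm]
  · rw [← hW.norm_sqrt_sq]; positivity
  · rintro _ ⟨k, hk, rfl⟩
    exact h k hk
  · obtain ⟨k, hk, hv, -⟩ := u.exists_isIncr hl v
    refine ⟨_, Submodule.mem_map_of_mem hk, (hg u v k hv).trans ?_⟩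
    have := hv.norm_le_norm_gLp_sub hl
    gcongr
    exact le_add_of_nonneg_right (by positivity)
  · refine (congrArg norm ?_).trans_le ((hg u _ _ (hz t)).trans ?_)
    · rw [map_smul]
    · rw [Prod.smul_snd, Prod.smul_fst, norm_smul, mul_pow, norm_neg, Real.norm_eq_abs, sq_abs]
      nlinarith [mul_nonneg hC (sq_nonneg t)]

/-- Completing the square, once the linear term is written through the representative k₀. -/
theorem auxF_eq_sq (hl : 0 < l) (u : S1D l bu₁ bu₂ bv) {k₀ k : Quad l}
    (h : inner ℝ (mulLp (μS l) (Cbar QW) (gLp hl u)) (linLp hl u.w k) =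
      inner ℝ (mulLp (μS l) (sqrtCbar QR) (linLp hl u.w k₀))
        (mulLp (μS l) (sqrtCbar QR) (linLp hl u.w k))) {p : TestSpace l}
    (hp : hLp hl p u.w = linLp hl u.w k) :
    auxF QW QR u p = 1 / 2 * ‖mulLp (μS l) (sqrtCbar QR) (linLp hl u.w (k - k₀))‖ ^ 2
      - 1 / 2 * ‖mulLp (μS l) (sqrtCbar QR) (linLp hl u.w k₀)‖ ^ 2 := by
  rw [auxF_eq hl, hp, h, map_sub, map_sub, norm_sub_sq_real, real_inner_comm]
  ring

end Main

end Ribbon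
end

/-! ### The operator L and the three assertions -/

open Ribbon in
theorem lemma6p2
    (l : ℝ) (hl : 0 < l)
    (QW QR : QuadraticForm ℝ (Matrix (Fin 2) (Fin 2) ℝ))
    (hW : Ribbon.IsAdmissible QW) (hR : Ribbon.IsAdmissible QR)
    (bu₁ : Ribbon.W12 l) (bu₂ bv : Ribbon.W22 l) :
    (∀ u : Ribbon.S1D l bu₁ bu₂ bv, MemLp (Ribbon.G u) 2 (Ribbon.μS l)) ∧
    (∀ (p : Ribbon.TestSpace l) (w : Ribbon.W22 l), MemLp (Ribbon.H p w) 2 (Ribbon.μS l)) ∧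
    ∃ L : Ribbon.S1D l bu₁ bu₂ bv → Lp Ribbon.E3 2 (Ribbon.μS l),
      (∀ (u : Ribbon.S1D l bu₁ bu₂ bv) (p : Ribbon.TestSpace l),
        ∫ x in Ribbon.S l, inner ℝ (L u x) (Ribbon.H p u.w x) = 0) ∧
      (∀ u : Ribbon.S1D l bu₁ bu₂ bv,
        Ribbon.localSlope (Ribbon.energy QW) (Ribbon.dist0 QR) u =
          eLpNorm (fun x => (Ribbon.sqrtCbar QR)⁻¹.toEuclideanLin
            ((Ribbon.Cbar QW).toEuclideanLin (Ribbon.G u x) + L u x)) 2 (Ribbon.μS l)) ∧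
      (∀ u : Ribbon.S1D l bu₁ bu₂ bv, ∃ p : Ribbon.TestSpace l,
        (∀ q, Ribbon.auxF QW QR u p ≤ Ribbon.auxF QW QR u q) ∧
        (∀ p', (∀ q, Ribbon.auxF QW QR u p' ≤ Ribbon.auxF QW QR u q) → p' = p) ∧
        L u =ᵐ[Ribbon.μS l] fun x =>
          (Ribbon.Cbar QR).toEuclideanLin (Ribbon.H p u.w x)
            - (Ribbon.Cbar QW).toEuclideanLin (Ribbon.G u x)) := by
  refine ⟨fun u => (memLp_congr_ae (coeFn_gLp hl u)).1 (Lp.memLp _),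
    fun p w => (memLp_congr_ae (coeFn_hLp hl p w)).1 (Lp.memLp _), ?_⟩
  obtain ⟨o, ho⟩ := exists_zero_testSpace hl
  choose k₀ hk₀ hproj using fun u : S1D l bu₁ bu₂ bv =>
    hR.exists_mem_incr hl u.w (mulLp (μS l) (Cbar QW) (gLp hl u))
  let L : S1D l bu₁ bu₂ bv → Lp E3 2 (μS l) := fun u =>
    mulLp (μS l) (Cbar QR) (linLp hl u.w (k₀ u)) - mulLp (μS l) (Cbar QW) (gLp hl u)
  refine ⟨L, fun u p => ?_, fun u => ?_, fun u => ?_⟩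
  · obtain ⟨k, hk, hp, -⟩ := o.exists_isIncr hl p
    have e : ∫ x in S l, inner ℝ (L u x) (H p u.w x) = inner ℝ (L u) (linLp hl u.w k) := by
      rw [← hp.hLp_eq hl ho, L2.inner_def]
      refine integral_congr_ae ?_
      filter_upwards [coeFn_hLp hl p u.w] with x hx
      rw [hx]
    rw [e, inner_sub_left, hproj u k hk, ← hR.sqrtCbar_mul_self, ← mulLp_mul,
      inner_mulLp_left (sqrtCbar_posSemidef QR).isHermitian, sub_self]
  · rw [hW.localSlope_eq hR hl u (hk₀ u) (hproj u)]
    -- C̄_W G(u) + L(u) is C̄_R h₀, and one factor of the square root cancels.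
    have e : mulLp (μS l) (sqrtCbar QR) (linLp hl u.w (k₀ u)) =
        mulLp (μS l) (sqrtCbar QR)⁻¹ (mulLp (μS l) (Cbar QW) (gLp hl u) + L u) := by
      rw [add_sub_cancel, ← hR.sqrtCbar_mul_self, ← mulLp_mul, hR.mulLp_inv_sqrt]
    rw [e, Lp.norm_def, ENNReal.ofReal_toReal (Lp.eLpNorm_ne_top _)]
    refine eLpNorm_congr_ae ?_
    filter_upwards [coeFn_mulLp (sqrtCbar QR)⁻¹ (mulLp (μS l) (Cbar QW) (gLp hl u) + L u),
      Lp.coeFn_add (mulLp (μS l) (Cbar QW) (gLp hl u)) (L u), coeFn_mulLp (Cbar QW) (gLp hl u),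
      coeFn_gLp hl u] with x h1 h2 h3 h4
    rw [h1, h2, Pi.add_apply, h3, h4]
  · obtain ⟨p, hp⟩ := o.exists_isIncr_of_mem hl (hk₀ u)
    have hpk := hp.hLp_eq hl ho u.w
    have hmin : auxF QW QR u p =
        - (1 / 2 * ‖mulLp (μS l) (sqrtCbar QR) (linLp hl u.w (k₀ u))‖ ^ 2) := by
      rw [auxF_eq_sq hl u (hproj u _ (hk₀ u)) hpk, sub_self, map_zero, map_zero]
      simp
    obtain ⟨c, hc, hRc⟩ := hR.exists_norm_le_mulLp_sqrt l
    obtain ⟨K, hK, hKk⟩ := exists_norm_le_linLp hl u.w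
    refine ⟨p, fun q => ?_, fun p' hp' => ?_, ?_⟩
    · obtain ⟨k, hk, hq, -⟩ := o.exists_isIncr hl q
      rw [hmin, auxF_eq_sq hl u (hproj u k hk) (hq.hLp_eq hl ho u.w)]
      have := sq_nonneg ‖mulLp (μS l) (sqrtCbar QR) (linLp hl u.w (k - k₀ u))‖
      linarith
    -- The competitor is written both as an increment k of the minimizer p and as an increment k' of
    -- the base point. Minimality forces k' = k₀, so p and p' have equal strains and highest
    -- derivatives, hence k = 0 and p' = p.
    · obtain ⟨k, hk, hpp, hzero⟩ := p.exists_isIncr hl p'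
      obtain ⟨k', hk', hq, -⟩ := o.exists_isIncr hl p'
      have h1 := hp' p
      rw [hmin, auxF_eq_sq hl u (hproj u k' hk') (hq.hLp_eq hl ho u.w)] at h1
      have h2 : mulLp (μS l) (sqrtCbar QR) (linLp hl u.w (k' - k₀ u)) = 0 := by
        rw [← norm_le_zero_iff]
        nlinarith [norm_nonneg (mulLp (μS l) (sqrtCbar QR) (linLp hl u.w (k' - k₀ u)))]
      have h3 : linLp hl u.w (k' - k₀ u) = 0 := by
        have := hRc (linLp hl u.w (k' - k₀ u))
        rw [h2, norm_zero] at this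
        rw [← norm_le_zero_iff]
        nlinarith [norm_nonneg (linLp hl u.w (k' - k₀ u))]
      have h4 := hKk (k' - k₀ u)
      rw [h3, norm_zero, mul_zero, norm_le_zero_iff, sub_eq_zero] at h4
      refine hzero ?_
      have e1 : strainLp l k.1 = 0 := by
        have := hpp.strain
        rwa [hp.strain, hq.strain, h4, left_eq_add] at this
      have e2 : k.2.1 = 0 := by
        have := hpp.w_d2
        rwa [hp.w_d2, hq.w_d2, h4, left_eq_add] at this
      have e3 : k.2.2 = 0 := by
        have := hpp.θ_d1
        rwa [hp.θ_d1, hq.θ_d1, h4, left_eq_add] at this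
      obtain ⟨n1, n2⟩ := norm_le_norm_strainLp k.1.1 k.1.2
      rw [Prod.mk.eta, e1, norm_zero] at n1 n2
      rw [mul_zero] at n2
      exact Prod.ext (Prod.ext (norm_le_zero_iff.1 n1) (norm_le_zero_iff.1 n2)) (Prod.ext e2 e3)
    · have e : L u = mulLp (μS l) (Cbar QR) (hLp hl p u.w) - mulLp (μS l) (Cbar QW) (gLp hl u) := by
        rw [hpk]
      rw [e]
      filter_upwards [Lp.coeFn_sub (mulLp (μS l) (Cbar QR) (hLp hl p u.w))
          (mulLp (μS l) (Cbar QW) (gLp hl u)), coeFn_mulLp (Cbar QR) (hLp hl p u.w),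
        coeFn_mulLp (Cbar QW) (gLp hl u), coeFn_gLp hl u, coeFn_hLp hl p u.w] with x h1 h2 h3 h4 h5
      rw [h1, Pi.sub_apply, h2, h3, h4, h5]
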